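/- Let $A_1,\dots,A_r$ be complex $m\times n$ matrices and let $T(X)=\sum_{i=1}^r A_iXA_i^\dagger$, a completely positive map from $n\times n$ to $m\times m$ complex matrices, with dual $T^*(Y)=\sum_i A_i^\dagger YA_i$. Let $P=\operatorname{diag}(p_1,\dots,p_n)$ and $Q=\operatorname{diag}(q_1,\dots,q_m)$ with $p_1\ge\dots\ge p_n\ge 0$ and $q_1\ge\dots\ge q_m\ge 0$. Notation. For $a_1\ge\dots\ge a_k\ge 0$ put $\Delta a_i=a_i-a_{i+1}$, where $a_{k+1}:=0$. Let $E_i\subset\mathbb C^m$ and $F_j\subset\mathbb C^n$ be the spans of the first $i$, respectively $j$, standard basis vectors, and let $\operatorname{GL}(E_\bullet)\subset\operatorname{GL}_m(\mathbb C)$ and $\operatorname{GL}(F_\bullet)\subset\operatorname{GL}_n(\mathbb C)$ be the groups of invertible upper-triangular matrices. * Subspaces $L\subset\mathbb C^m$, $R\subset\mathbb C^n$ form a *$T$-independent* pair if $L\perp A_iR$ for all $i$. $T$ is *$(P,Q)$-rank-nondecreasing* if for all $T$-independent pairs $(L,R)$ $$\sum_{i=1}^m\Delta q_i\dim(E_i\cap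 L)+\sum_{j=1}^n\Delta p_j\dim(F_j\cap R)\le\operatorname{Tr}P .$$ * For a positive semidefinite $k\times k$ matrix $X$ let $\det(\operatorname{diag}(a),X)=\prod_{j=1}^k(\det X_j)^{\Delta a_j}$, where $X_j$ is the leading $j\times j$ block of $X$ and $0^0=1$. Let $$\operatorname{cap}(T,P,Q)=\inf_{h\in\operatorname{GL}(F_\bullet)}\frac{\det(Q,T(hPh^\dagger))}{\det(P,h^\dagger h)} .$$ * For invertible $g,h$ let $T_{g,h}(X)=g^\dagger T(hXh^\dagger)g$. $T$ is *approximately $\operatorname{GL}(E_\bullet)\times\operatorname{GL}(F_\bullet)$-scalable to $(I_n\to Q,\ I_m\to P)$* if for every $\epsilon>0$ there are $g\in\operatorname{GL}(E_\bullet)$ and $h\in\operatorname{GL}(F_\bullet)$ with $\|T_{g,h}(I_n)-Q\|\le\epsilon$ and $\|(T_{g,h})^*(I_m)-P\|\le\epsilon$, where $\|X\|=\sqrt{\operatorname{Tr}XX^\dagger}$. **Theorem.** The following are equivalent: 1. $\operatorname{Tr}P=\operatorname{Tr}Q$ and $T$ is $(P,Q)$-rank-nondecreasing. 2. $\operatorname{cap}(T,P,Q)>0$.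 3. $T$ is approximately $\operatorname{GL}(E_\bullet)\times\operatorname{GL}(F_\bullet)$-scalable to $(I_n\to Q,\ I_m\to P)$. Moreover, for fixed $T$, the set of pairs $(\mathbf p,\mathbf q)$ of nonincreasing nonnegative sequences, each with sum one, for which $T$ is $(P,Q)$-rank-nondecreasing (equivalently (2), equivalently (3)) is a (possibly empty) convex polytope with rational vertices, i.e. the convex hull of a finite set of points with rational coordinates. -/

import Mathlib

open scoped Matrix

namespace OpScaling

/-- The completely positive map `X ↦ ∑ i, A i * X * (A i)†` from `n × n` to `m × m` complex
matrices with Kraus operators `A 1, …, A r`. -/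
def krausMap {m n r : ℕ} (A : Fin r → Matrix (Fin m) (Fin n) ℂ)
    (X : Matrix (Fin n) (Fin n) ℂ) : Matrix (Fin m) (Fin m) ℂ :=
  ∑ i, A i * X * (A i)ᴴ

/-- Kraus operators of the dual map `T* : X ↦ ∑ i, (A i)† * X * A i`. -/
def dualKraus {m n r : ℕ} (A : Fin r → Matrix (Fin m) (Fin n) ℂ) :
    Fin r → Matrix (Fin n) (Fin m) ℂ :=
  fun i => (A i)ᴴ

/-- The dual map is the adjoint of `T` for the trace inner product `⟨A, B⟩ = Tr (A† B)`. -/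
theorem trace_dualKraus {m n r : ℕ} (A : Fin r → Matrix (Fin m) (Fin n) ℂ)
    (X : Matrix (Fin n) (Fin n) ℂ) (Y : Matrix (Fin m) (Fin m) ℂ) :
    ((krausMap (dualKraus A) Y)ᴴ * X).trace = (Yᴴ * krausMap A X).trace := by
  simp only [krausMap, dualKraus, Matrix.conjTranspose_sum, Matrix.sum_mul, Matrix.mul_sum,
    Matrix.trace_sum, Matrix.conjTranspose_mul, Matrix.conjTranspose_conjTranspose]
  refine Finset.sum_congr rfl fun i _ => ?_
  rw [Matrix.mul_assoc, Matrix.trace_mul_comm]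
  simp only [Matrix.mul_assoc]

/-- Kraus operators `g† * A i * h` of the scaling `T_{g,h} : X ↦ g† T(h X h†) g`. -/
def scaleKraus {m n r : ℕ} (g : GL (Fin m) ℂ) (h : GL (Fin n) ℂ)
    (A : Fin r → Matrix (Fin m) (Fin n) ℂ) : Fin r → Matrix (Fin m) (Fin n) ℂ :=
  fun i => (g : Matrix (Fin m) (Fin m) ℂ)ᴴ * A i * (h : Matrix (Fin n) (Fin n) ℂ)

theorem krausMap_scaleKraus {m n r : ℕ} (g : GL (Fin m) ℂ) (h : GL (Fin n) ℂ)
    (A : Fin r → Matrix (Fin m) (Fin n) ℂ) (X : Matrix (Fin n) (Fin n) ℂ) :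
    krausMap (scaleKraus g h A) X =
      (g : Matrix (Fin m) (Fin m) ℂ)ᴴ *
        krausMap A ((h : Matrix (Fin n) (Fin n) ℂ) * X * (h : Matrix (Fin n) (Fin n) ℂ)ᴴ) *
        (g : Matrix (Fin m) (Fin m) ℂ) := by
  simp only [krausMap, scaleKraus, Matrix.mul_sum, Matrix.sum_mul, Matrix.conjTranspose_mul,
    Matrix.conjTranspose_conjTranspose, Matrix.mul_assoc]

/-- The norm `‖X‖ = √(Tr X X†)`. -/
noncomputable def frobNorm {k : ℕ} (X : Matrix (Fin k) (Fin k) ℂ) : ℝ :=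
  Real.sqrt (X * Xᴴ).trace.re

/-- The real diagonal matrix `diag(a)`, as a complex matrix. -/
noncomputable def diagC {k : ℕ} (a : Fin k → ℝ) : Matrix (Fin k) (Fin k) ℂ :=
  Matrix.diagonal fun i => (a i : ℂ)

/-- `T' = krausMap A` sends `B` to a point within `ε` of `B'`, and its dual sends `C` to a point
within `ε` of `C'`. -/
def MapsApprox {m n r : ℕ} (ε : ℝ) (A : Fin r → Matrix (Fin m) (Fin n) ℂ)
    (B : Matrix (Fin n) (Fin n) ℂ) (B' : Matrix (Fin m) (Fin m) ℂ)
    (C : Matrix (Fin m) (Fin m) ℂ) (C' : Matrix (Fin n) (Fin n) ℂ) : Prop :=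
  frobNorm (B' - krausMap A B) ≤ ε ∧ frobNorm (C' - krausMap (dualKraus A) C) ≤ ε

/-- `T = krausMap A` is approximately `G × H`-scalable to `(B → B', C → C')`: for every `ε > 0`
some scaling `T_{g,h}` with `g ∈ G`, `h ∈ H` is an `ε`-`(B → B', C → C')`-scaling. -/
def ApproxScalable {m n r : ℕ} (G : Set (GL (Fin m) ℂ)) (H : Set (GL (Fin n) ℂ))
    (A : Fin r → Matrix (Fin m) (Fin n) ℂ)
    (B : Matrix (Fin n) (Fin n) ℂ) (B' : Matrix (Fin m) (Fin m) ℂ)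
    (C : Matrix (Fin m) (Fin m) ℂ) (C' : Matrix (Fin n) (Fin n) ℂ) : Prop :=
  ∀ ε : ℝ, 0 < ε → ∃ g ∈ G, ∃ h ∈ H, MapsApprox ε (scaleKraus g h A) B B' C C'

/-- The invertible upper triangular matrices, that is, the stabilizer of the standard flag. -/
def upperGL (k : ℕ) : Set (GL (Fin k) ℂ) :=
  {g | (g : Matrix (Fin k) (Fin k) ℂ).BlockTriangular id}

/-- The difference `Δ a_i = a_i - a_{i+1}`, with `a_{k+1} = 0`. -/
def delta {k : ℕ} (a : Fin k → ℝ) (i : Fin k) : ℝ :=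
  a i - (if h : (i : ℕ) + 1 < k then a ⟨(i : ℕ) + 1, h⟩ else 0)

/-- The member of the standard flag of `ℂ^k` spanned by the basis vectors with index at most `i`.
As indices start at `0`, its dimension is `i + 1`. -/
def stdFlag {k : ℕ} (i : Fin k) : Submodule ℂ (Fin k → ℂ) :=
  Submodule.span ℂ ((fun l : Fin k => (Pi.single l (1 : ℂ) : Fin k → ℂ)) '' Set.Iic i)

/-- `(L, R)` is `T`-independent: `L` is orthogonal to `A i R` for every Kraus operator `A i`,
in the standard Hermitian inner product. -/
def Independent {m n r : ℕ} (A : Fin r → Matrix (Fin m) (Fin n) ℂ)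
    (L : Submodule ℂ (Fin m → ℂ)) (R : Submodule ℂ (Fin n → ℂ)) : Prop :=
  ∀ i, ∀ y ∈ L, ∀ x ∈ R, star y ⬝ᵥ (A i *ᵥ x) = 0

/-- `T = krausMap A` is `(P, Q)`-rank-nondecreasing for `P = diag(p)`, `Q = diag(q)`. -/
def RankNondecreasing {m n r : ℕ} (A : Fin r → Matrix (Fin m) (Fin n) ℂ)
    (p : Fin n → ℝ) (q : Fin m → ℝ) : Prop :=
  ∀ (L : Submodule ℂ (Fin m → ℂ)) (R : Submodule ℂ (Fin n → ℂ)), Independent A L R →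
    ∑ i, delta q i * (Module.finrank ℂ ↥(stdFlag i ⊓ L) : ℝ) +
      ∑ j, delta p j * (Module.finrank ℂ ↥(stdFlag j ⊓ R) : ℝ) ≤ ∑ j, p j

/-- The leading principal block of `X` on the indices at most `j` (the first `j + 1` of them). -/
def leadingBlock {k : ℕ} (X : Matrix (Fin k) (Fin k) ℂ) (j : Fin k) :
    Matrix (Fin ((j : ℕ) + 1)) (Fin ((j : ℕ) + 1)) ℂ :=
  X.submatrix (Fin.castLE j.isLt) (Fin.castLE j.isLt)

open scoped ComplexOrder in
/-- For positive semidefinite `X` the leading principal minors are real and nonnegative, so that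
taking the real part in `relDet` loses nothing. -/
theorem det_leadingBlock {k : ℕ} {X : Matrix (Fin k) (Fin k) ℂ} (hX : X.PosSemidef)
    (j : Fin k) : 0 ≤ (leadingBlock X j).det.re ∧
      (((leadingBlock X j).det.re : ℝ) : ℂ) = (leadingBlock X j).det := by
  have h := (hX.submatrix (Fin.castLE j.isLt)).det_nonneg
  rw [Complex.le_def] at h
  exact ⟨h.1, Complex.ext rfl h.2⟩

/-- The determinant of a positive semidefinite `X` relative to `diag(a)`: the product over `j` of
the leading principal minors of `X` to the powers `Δ a_j`, where `0 ^ 0 = 1`. -/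
noncomputable def relDet {k : ℕ} (a : Fin k → ℝ) (X : Matrix (Fin k) (Fin k) ℂ) : ℝ :=
  ∏ j, (leadingBlock X j).det.re ^ delta a j

/-- The capacity `cap(T, P, Q)` of `T = krausMap A`, for `P = diag(p)` and `Q = diag(q)`: the
infimum of `det(Q, T(h P h†)) / det(P, h† h)` over invertible upper triangular `h`. -/
noncomputable def capacity {m n r : ℕ} (A : Fin r → Matrix (Fin m) (Fin n) ℂ)
    (p : Fin n → ℝ) (q : Fin m → ℝ) : ℝ :=
  ⨅ h : upperGL n,
    relDet q (krausMap A ((h : GL (Fin n) ℂ).val * diagC p * (h : GL (Fin n) ℂ).valᴴ)) /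
      relDet p ((h : GL (Fin n) ℂ).valᴴ * (h : GL (Fin n) ℂ).val)

/-- `T = krausMap A` is approximately scalable by invertible upper triangular pairs to
`(I_n → Q, I_m → P)`, for `P = diag(p)` and `Q = diag(q)`. -/
def TriangularScalable {m n r : ℕ} (A : Fin r → Matrix (Fin m) (Fin n) ℂ)
    (p : Fin n → ℝ) (q : Fin m → ℝ) : Prop :=
  ApproxScalable (upperGL m) (upperGL n) A 1 (diagC q) 1 (diagC p)

/-- `a` is a nonincreasing sequence of nonnegative reals. -/
def IsSpectrum {k : ℕ} (a : Fin k → ℝ) : Prop :=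
  Antitone a ∧ ∀ i, 0 ≤ a i

/-- The pairs of nonincreasing nonnegative sequences, each with sum one. -/
def unitSpectra (n m : ℕ) : Set ((Fin n → ℝ) × (Fin m → ℝ)) :=
  {x | IsSpectrum x.1 ∧ IsSpectrum x.2 ∧ ∑ j, x.1 j = 1 ∧ ∑ i, x.2 i = 1}

/-- All coordinates of `x` are rational numbers. -/
def IsRationalPoint {n m : ℕ} (x : (Fin n → ℝ) × (Fin m → ℝ)) : Prop :=
  (∀ j, ∃ c : ℚ, x.1 j = c) ∧ ∀ i, ∃ c : ℚ, x.2 i = c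

end OpScaling

namespace OpScaling

open scoped ComplexOrder
open Matrix

/-! The relative determinant is multiplicative under triangular congruence (`relDet_upper_conj`),
and it obeys a weighted AM–GM inequality `relDet a W ≤ exp (∑ a i * W i i - ∑ a i)` with a stable
equality case: near equality, `√a W √a` is near `a` (`exists_frobNorm_le`).

Positive capacity gives scalability. Take `h` almost minimizing the quotient and let `g` be a
Cholesky factor normalizing `T(h P h†)`. The scaled map then almost attains equality in AM–GM; so
does the scaled dual, since otherwise a further triangular change of `h` would push the quotient
below the infimum (`exists_relDet_near`). Multiplying `g`, `h` by slightly perturbed `√Q`, `√P`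
yields the scaling.

Scalability gives the rank condition. For an independent pair with orthogonal projections `π`, `ρ`,
positivity of `Tr (1 - π) T(1 - ρ)` bounds `Tr T(1) π + Tr T*(1) ρ` by `Tr T*(1)`
(`Independent.trace_add_le`). Triangular scalings preserve the flags, so this applies to the scaled
pair, and the weighted dimensions are at most `Tr Q π` and `Tr P ρ`.

The rank condition gives positive capacity. It is enough to bound `relDet q (T X) * relDet p X⁻¹`
below over positive definite `X`. Write `X = V e^x V†` with `x` decreasing. Each leading minor
dominates one Cauchy–Binet term, and choosing its columns greedily gives a monomial in `e^x` whose
exponents have large partial sums. The rank condition for the first `K` eigenvectors says that the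
total exponent is nonnegative (`exists_local_lower_bound`); compactness of the unitary group makes
the constant uniform.

For the polytope, only finitely many dimension vectors occur, so the conditions are finitely many
linear inequalities with rational data inside a box. A vertex is determined by its active
inequalities; applying a `ℚ`-linear retraction `ℝ → ℚ` to its coordinates preserves these, so the
vertex is rational. -/

/-! ### Summation by parts for the differences `Δ a`. -/

theorem sum_range_sub_mul_sum (a f : ℕ → ℝ) (k : ℕ) :
    ∑ j ∈ Finset.range k, (a j - a (j + 1)) * ∑ i ∈ Finset.range (j + 1), f i =
      ∑ j ∈ Finset.range k, a j * f j - a k * ∑ i ∈ Finset.range k, f i := by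
  induction k with
  | zero => simp
  | succ k ih =>
    rw [Finset.sum_range_succ, ih, Finset.sum_range_succ (fun j => a j * f j),
      Finset.sum_range_succ f]
    ring

/-- Summation by parts. -/
theorem sum_delta_mul {k : ℕ} (a f : Fin k → ℝ) :
    ∑ j, delta a j * ∑ i : Fin ((j : ℕ) + 1), f (Fin.castLE j.isLt i) = ∑ i, a i * f i := by
  -- Extending by zero kills the boundary term `a k` and agrees with the default value in `delta`.
  have h := sum_range_sub_mul_sum (fun n => if h : n < k then a ⟨n, h⟩ else 0)
    (fun n => if h : n < k then f ⟨n, h⟩ else 0) k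
  rw [← Fin.sum_univ_eq_sum_range (fun j => ((if h : j < k then a ⟨j, h⟩ else 0) -
      (if h : j + 1 < k then a ⟨j + 1, h⟩ else 0)) * ∑ i ∈ Finset.range (j + 1),
      (if h : i < k then f ⟨i, h⟩ else 0)) k,
    ← Fin.sum_univ_eq_sum_range (fun j => (if h : j < k then a ⟨j, h⟩ else 0) *
      (if h : j < k then f ⟨j, h⟩ else 0)) k] at h
  simp only [Fin.is_lt, dif_pos, Fin.eta, lt_irrefl, dif_neg, not_false_iff, zero_mul,
    sub_zero] at h
  rw [← h]
  refine Finset.sum_congr rfl fun j _ => ?_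
  rw [← Fin.sum_univ_eq_sum_range (fun i => if h : i < k then f ⟨i, h⟩ else 0) ((j : ℕ) + 1)]
  congr 1
  refine Finset.sum_congr rfl fun i _ => ?_
  rw [dif_pos (lt_of_lt_of_le i.isLt j.isLt)]
  rfl

/-- The block with index `j` has size `j + 1`, so this is the degree of homogeneity of `relDet a`.
-/
theorem sum_delta_mul_card {k : ℕ} (a : Fin k → ℝ) :
    ∑ j, delta a j * (((j : ℕ) : ℝ) + 1) = ∑ i, a i := by
  simpa using sum_delta_mul a fun _ => 1

theorem sum_fin_castLE_single {k : ℕ} (l j : Fin k) :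
    ∑ i : Fin ((j : ℕ) + 1), (if Fin.castLE j.isLt i = l then (1 : ℝ) else 0) =
      if l ≤ j then 1 else 0 := by
  split_ifs with h
  · rw [Finset.sum_eq_single_of_mem (⟨l, Nat.lt_succ_of_le h⟩ : Fin ((j : ℕ) + 1))
      (Finset.mem_univ _)]
    · simp
    · intro b _ hb
      rw [if_neg]
      intro hbl
      exact hb (Fin.ext (by simpa using congrArg Fin.val hbl))
  · refine Finset.sum_eq_zero fun i _ => if_neg ?_
    rintro rfl
    exact h (Nat.le_of_lt_succ i.isLt)

theorem sum_delta_of_le {k : ℕ} (a : Fin k → ℝ) (l : Fin k) :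
    ∑ j, delta a j * (if l ≤ j then 1 else 0) = a l := by
  have h := sum_delta_mul a fun i => if i = l then 1 else 0
  simp only [sum_fin_castLE_single] at h
  rw [h]
  simp

theorem IsSpectrum.delta_nonneg {k : ℕ} {a : Fin k → ℝ} (ha : IsSpectrum a) (j : Fin k) :
    0 ≤ delta a j := by
  unfold delta
  split_ifs with h
  · exact sub_nonneg.2 (ha.1 (Fin.le_def.2 (Nat.le_succ _)))
  · simpa using ha.2 j

/-! ### Leading minors and relative determinants under triangular congruence. -/

theorem sum_castLE_of_zero {M : Type*} [AddCommMonoid M] {k : ℕ} (j : Fin k) (f : Fin k → M)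
    (hf : ∀ i, j < i → f i = 0) :
    ∑ i : Fin ((j : ℕ) + 1), f (Fin.castLE j.isLt i) = ∑ i, f i := by
  refine Finset.sum_of_injOn (Fin.castLE j.isLt) (Fin.castLE_injective _).injOn
    (fun _ _ => Finset.mem_univ _) ?_ fun _ _ => rfl
  intro i _ hi
  refine hf i (lt_of_not_ge fun hij => hi ?_)
  exact ⟨⟨i, Nat.lt_succ_of_le hij⟩, by simp, rfl⟩

/-- A column of `g` with index at most `j` vanishes below row `j`, so truncating the inner sum loses
nothing. -/
theorem leadingBlock_mul_upper {k : ℕ} (X : Matrix (Fin k) (Fin k) ℂ)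
    {g : Matrix (Fin k) (Fin k) ℂ} (hg : g.BlockTriangular id) (j : Fin k) :
    leadingBlock (X * g) j = leadingBlock X j * leadingBlock g j := by
  ext a b
  simp only [leadingBlock, submatrix_apply, mul_apply]
  refine (sum_castLE_of_zero j (fun c => X (Fin.castLE j.isLt a) c * g c (Fin.castLE j.isLt b))
    fun c hc => ?_).symm
  have : g c (Fin.castLE j.isLt b) = 0 := by
    refine hg (lt_of_le_of_lt ?_ hc)
    exact Nat.le_of_lt_succ b.isLt
  rw [this, mul_zero]

theorem leadingBlock_conjTranspose {k : ℕ} (X : Matrix (Fin k) (Fin k) ℂ) (j : Fin k) :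
    leadingBlock Xᴴ j = (leadingBlock X j)ᴴ := rfl

theorem leadingBlock_upper_conj {k : ℕ} (X : Matrix (Fin k) (Fin k) ℂ)
    {g : Matrix (Fin k) (Fin k) ℂ} (hg : g.BlockTriangular id) (j : Fin k) :
    leadingBlock (gᴴ * X * g) j = (leadingBlock g j)ᴴ * leadingBlock X j * leadingBlock g j := by
  rw [leadingBlock_mul_upper _ hg, ← conjTranspose_conjTranspose (gᴴ * X), conjTranspose_mul,
    conjTranspose_conjTranspose, leadingBlock_conjTranspose, leadingBlock_mul_upper _ hg,
    conjTranspose_mul, leadingBlock_conjTranspose, conjTranspose_conjTranspose]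

theorem det_leadingBlock_upper {k : ℕ} {g : Matrix (Fin k) (Fin k) ℂ}
    (hg : g.BlockTriangular id) (j : Fin k) :
    (leadingBlock g j).det = ∏ i : Fin ((j : ℕ) + 1), g (Fin.castLE j.isLt i)
      (Fin.castLE j.isLt i) := by
  rw [det_of_isUpperTriangular]
  · rfl
  · intro a b hab
    exact hg hab

theorem upperGL_diag_ne_zero {k : ℕ} {g : GL (Fin k) ℂ} (hg : g ∈ upperGL k) (i : Fin k) :
    g.val i i ≠ 0 := by
  have h : g.val.det ≠ 0 := (g.isUnit.map (Matrix.detMonoidHom)).ne_zero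
  rw [det_of_isUpperTriangular hg] at h
  exact Finset.prod_ne_zero_iff.1 h i (Finset.mem_univ _)

theorem det_leadingBlock_upper_ne_zero {k : ℕ} {g : GL (Fin k) ℂ} (hg : g ∈ upperGL k)
    (j : Fin k) : (leadingBlock g.val j).det ≠ 0 := by
  rw [det_leadingBlock_upper hg]
  exact Finset.prod_ne_zero_iff.2 fun i _ => upperGL_diag_ne_zero hg _

theorem det_leadingBlock_upper_conj {k : ℕ} (X : Matrix (Fin k) (Fin k) ℂ)
    {g : Matrix (Fin k) (Fin k) ℂ} (hg : g.BlockTriangular id) (j : Fin k) :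
    (leadingBlock (gᴴ * X * g) j).det.re =
      Complex.normSq (leadingBlock g j).det * (leadingBlock X j).det.re := by
  rw [leadingBlock_upper_conj _ hg, det_mul, det_mul, det_conjTranspose, mul_right_comm,
    Complex.star_def, ← Complex.normSq_eq_conj_mul_self, Complex.re_ofReal_mul]

theorem leadingBlock_one {k : ℕ} (j : Fin k) :
    leadingBlock (1 : Matrix (Fin k) (Fin k) ℂ) j = 1 :=
  submatrix_one _ (Fin.castLE_injective _)

theorem det_leadingBlock_upper_self {k : ℕ}
    {g : Matrix (Fin k) (Fin k) ℂ} (hg : g.BlockTriangular id) (j : Fin k) :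
    (leadingBlock (gᴴ * g) j).det.re = Complex.normSq (leadingBlock g j).det := by
  have := det_leadingBlock_upper_conj 1 hg j
  rwa [Matrix.mul_one, leadingBlock_one, det_one, Complex.one_re, mul_one] at this

theorem relDet_one {k : ℕ} (a : Fin k → ℝ) : relDet a 1 = 1 := by
  simp [relDet, leadingBlock_one]

theorem relDet_nonneg {k : ℕ} (a : Fin k → ℝ) {X : Matrix (Fin k) (Fin k) ℂ}
    (hX : X.PosSemidef) : 0 ≤ relDet a X :=
  Finset.prod_nonneg fun j _ => Real.rpow_nonneg (det_leadingBlock hX j).1 _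

/-- Each leading minor is multiplied by `|det g_j|²`, where `g_j` is the leading block of `g`. This
multiplicativity is what ties the capacity to triangular groups. -/
theorem relDet_upper_conj {k : ℕ} (a : Fin k → ℝ) {X : Matrix (Fin k) (Fin k) ℂ}
    (hX : X.PosSemidef) {g : Matrix (Fin k) (Fin k) ℂ} (hg : g.BlockTriangular id) :
    relDet a (gᴴ * X * g) = relDet a (gᴴ * g) * relDet a X := by
  simp only [relDet, ← Finset.prod_mul_distrib]
  refine Finset.prod_congr rfl fun j _ => ?_
  rw [det_leadingBlock_upper_conj _ hg, det_leadingBlock_upper_self hg,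
    Real.mul_rpow (Complex.normSq_nonneg _) (det_leadingBlock hX j).1]

theorem relDet_upper_pos {k : ℕ} (a : Fin k → ℝ) {g : GL (Fin k) ℂ} (hg : g ∈ upperGL k) :
    0 < relDet a (g.valᴴ * g.val) := by
  refine Finset.prod_pos fun j _ => Real.rpow_pos_of_pos ?_ _
  rw [det_leadingBlock_upper_self hg]
  exact Complex.normSq_pos.2 (det_leadingBlock_upper_ne_zero hg j)

theorem mul_mem_upperGL {k : ℕ} {g h : GL (Fin k) ℂ} (hg : g ∈ upperGL k) (hh : h ∈ upperGL k) :
    g * h ∈ upperGL k :=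
  BlockTriangular.mul hg hh

theorem one_mem_upperGL (k : ℕ) : (1 : GL (Fin k) ℂ) ∈ upperGL k :=
  blockTriangular_one

theorem inv_mem_upperGL {k : ℕ} {g : GL (Fin k) ℂ} (hg : g ∈ upperGL k) : g⁻¹ ∈ upperGL k := by
  let : Invertible g.val := g.isUnit.invertible
  have := blockTriangular_inv_of_blockTriangular (M := g.val) hg
  rwa [← Matrix.coe_units_inv] at this

theorem relDet_upper_mul {k : ℕ} (a : Fin k → ℝ) {g h : GL (Fin k) ℂ} (hh : h ∈ upperGL k) :
    relDet a ((g * h).valᴴ * (g * h).val) =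
      relDet a (g.valᴴ * g.val) * relDet a (h.valᴴ * h.val) := by
  have := relDet_upper_conj a (posSemidef_conjTranspose_mul_self g.val) hh
  rw [mul_comm, ← this]
  simp only [Units.val_mul, conjTranspose_mul, Matrix.mul_assoc]

/-- Cholesky factorization. -/
theorem exists_upperGL_conj_eq_one {k : ℕ} {Y : Matrix (Fin k) (Fin k) ℂ} (hY : Y.PosDef) :
    ∃ g ∈ upperGL k, g.valᴴ * Y * g.val = 1 := by
  set B := LDL.lowerInv hY with hB
  have hd := LDL.diag_eq_lowerInv_conj hY
  have hBu : IsUnit B := isUnit_of_invertible B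
  have hD : (B * Y * Bᴴ).PosDef := by
    have := (Matrix.IsUnit.posDef_star_right_conjugate_iff (x := Y) hBu).2 hY
    simpa [star_eq_conjTranspose] using this
  rw [← hB, LDL.diag] at hd
  rw [← hd, posDef_diagonal_iff] at hD
  set d := LDL.diagEntries hY
  have hdr : ∀ i, ((d i).re : ℂ) = d i := fun i => by
    have := hD i
    rw [Complex.lt_def] at this
    exact Complex.ext rfl this.2
  have hdp : ∀ i, 0 < (d i).re := fun i => by
    have := hD i
    rw [Complex.lt_def] at this
    exact this.1
  -- Since `B * Y * Bᴴ` is diagonal with entries `d` and `B` is lower triangular, the factor sought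
  -- is `Bᴴ * d^(-1/2)`.
  set s : Fin k → ℂ := fun i => ((Real.sqrt (d i).re)⁻¹ : ℝ) with hs
  have hs0 : ∀ i, s i ≠ 0 := fun i => by
    simp [hs, Real.sqrt_ne_zero'.2 (hdp i)]
  have hsu : IsUnit (diagonal s) := by
    rw [isUnit_iff_isUnit_det, det_diagonal]
    exact (Finset.prod_ne_zero_iff.2 fun i _ => hs0 i).isUnit
  have hBc : IsUnit Bᴴ := hBu.star
  refine ⟨(hBc.mul hsu).unit, ?_, ?_⟩
  · change (Bᴴ * diagonal s).BlockTriangular id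
    refine BlockTriangular.mul (fun i j hij => ?_) (blockTriangular_diagonal _)
    have hz : B j i = 0 := LDL.lowerInv_triangular hY hij
    rw [conjTranspose_apply, hz, star_zero]
  · change (Bᴴ * diagonal s)ᴴ * Y * (Bᴴ * diagonal s) = 1
    rw [conjTranspose_mul, conjTranspose_conjTranspose]
    have : (diagonal s)ᴴ * B * Y * (Bᴴ * diagonal s) =
        (diagonal s)ᴴ * (B * Y * Bᴴ) * diagonal s := by simp only [Matrix.mul_assoc]
    rw [this, ← hd, diagonal_conjTranspose, diagonal_mul_diagonal, diagonal_mul_diagonal,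
      ← diagonal_one]
    congr 1
    ext i
    rw [Pi.star_apply, ← hdr i, hs]
    simp only [Complex.star_def, Complex.conj_ofReal]
    norm_cast
    have h2 := Real.mul_self_sqrt (hdp i).le
    have h3 : Real.sqrt (d i).re ≠ 0 := Real.sqrt_ne_zero'.2 (hdp i)
    nth_rewrite 2 [← h2]
    field_simp

theorem posDef_add_smul_one {k : ℕ} {X : Matrix (Fin k) (Fin k) ℂ} (hX : X.PosSemidef)
    {δ : ℝ} (hδ : 0 < δ) : (X + (δ : ℂ) • (1 : Matrix (Fin k) (Fin k) ℂ)).PosDef := by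
  refine PosDef.posSemidef_add hX (PosDef.smul PosDef.one ?_)
  exact_mod_cast hδ

/-- Minors may vanish, so continuity of the powers needs nonnegative exponents `Δ a`. It allows
singular matrices to be replaced by `X + δ` and `δ` to tend to zero. -/
theorem continuous_relDet {k : ℕ} {a : Fin k → ℝ} (ha : IsSpectrum a) :
    Continuous (relDet a) := by
  unfold relDet
  refine continuous_finsetProd _ fun j _ => ?_
  refine Continuous.rpow_const ?_ fun _ => Or.inr (ha.delta_nonneg j)
  refine Complex.continuous_re.comp (Continuous.matrix_det ?_)
  exact continuous_id.matrix_submatrix _ _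

/-! ### Determinant inequalities for positive semidefinite matrices. -/

theorem det_one_add_posSemidef {k : Type*} [Fintype k] [DecidableEq k] {B : Matrix k k ℂ}
    (hB : B.PosSemidef) : 1 ≤ (1 + B).det := by
  have h := hB.1.spectral_theorem
  rw [Unitary.conjStarAlgAut_apply] at h
  set U := hB.1.eigenvectorUnitary
  have h1 : (1 : Matrix k k ℂ) = (U : Matrix k k ℂ) * 1 * (star U : Matrix k k ℂ) := by simp
  rw [h, h1, ← add_mul, ← mul_add, det_mul_right_comm, ← Unitary.coe_star, Unitary.coe_mul_star_self, Matrix.one_mul,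
    ← diagonal_one, diagonal_add, det_diagonal]
  have : ∀ i, (1 : ℂ) ≤ 1 + ((RCLike.ofReal ∘ hB.1.eigenvalues) i) := fun i => by
    have := hB.eigenvalues_nonneg i
    simp only [Function.comp]
    simpa using this
  exact Finset.one_le_prod (fun i _ => this i)

/-- Congruence by a Cholesky factor of `A` reduces to `A = 1`. -/
theorem det_le_det_add {k : ℕ} {A B : Matrix (Fin k) (Fin k) ℂ} (hA : A.PosDef)
    (hB : B.PosSemidef) : A.det ≤ (A + B).det := by
  obtain ⟨g, -, hg⟩ := exists_upperGL_conj_eq_one hA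
  have h := det_one_add_posSemidef (hB.conjTranspose_mul_mul_same g.val)
  rw [← hg, ← Matrix.add_mul, ← Matrix.mul_add, det_mul, det_mul, mul_right_comm] at h
  have hg' := congrArg det hg
  rw [det_mul, det_mul, mul_right_comm, det_one] at hg'
  have := mul_le_mul_of_nonneg_left h hA.det_pos.le
  rwa [mul_one, ← mul_assoc, mul_comm A.det, hg', one_mul] at this

theorem PosSemidef.re_det_eq {k : Type*} [Fintype k] [DecidableEq k] {W : Matrix k k ℂ}
    (hW : W.PosSemidef) : W.det.re = ∏ i, hW.1.eigenvalues i := by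
  rw [hW.1.det_eq_prod_eigenvalues]
  norm_cast

theorem PosSemidef.re_trace_eq {k : Type*} [Fintype k] [DecidableEq k] {W : Matrix k k ℂ}
    (hW : W.PosSemidef) : W.trace.re = ∑ i, hW.1.eigenvalues i := by
  rw [hW.1.trace_eq_sum_eigenvalues]
  norm_cast

/-- Apply `t ≤ exp (t - 1)` to each eigenvalue: AM–GM in a form that is additive after taking
logarithms. -/
theorem re_det_le_exp {k : Type*} [Fintype k] [DecidableEq k] {W : Matrix k k ℂ}
    (hW : W.PosSemidef) : W.det.re ≤ Real.exp (W.trace.re - Fintype.card k) := by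
  rw [PosSemidef.re_det_eq hW, PosSemidef.re_trace_eq hW]
  have : ∑ i, hW.1.eigenvalues i - (Fintype.card k : ℝ) = ∑ i, (hW.1.eigenvalues i - 1) := by
    simp [Finset.sum_sub_distrib]
  rw [this, Real.exp_sum]
  refine Finset.prod_le_prod (fun i _ => hW.eigenvalues_nonneg i) fun i _ => ?_
  have := Real.add_one_le_exp (hW.1.eigenvalues i - 1)
  linarith

theorem re_trace_leadingBlock {k : ℕ} (W : Matrix (Fin k) (Fin k) ℂ) (j : Fin k) :
    (leadingBlock W j).trace.re =
      ∑ i : Fin ((j : ℕ) + 1), (W (Fin.castLE j.isLt i) (Fin.castLE j.isLt i)).re := by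
  simp [trace, leadingBlock]

theorem sum_delta_mul_trace {k : ℕ} (a : Fin k → ℝ) (W : Matrix (Fin k) (Fin k) ℂ) :
    ∑ j, delta a j * ((leadingBlock W j).trace.re - (((j : ℕ) : ℝ) + 1)) =
      ∑ i, a i * (W i i).re - ∑ i, a i := by
  simp only [mul_sub, Finset.sum_sub_distrib, sum_delta_mul_card, re_trace_leadingBlock]
  rw [sum_delta_mul a fun i => (W i i).re]

theorem PosSemidef.leadingBlock {k : ℕ} {W : Matrix (Fin k) (Fin k) ℂ} (hW : W.PosSemidef)
    (j : Fin k) : (leadingBlock W j).PosSemidef :=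
  hW.submatrix _

/-- Raise the block inequalities to the powers `Δ a j ≥ 0` and multiply; summation by parts collects
the block traces. -/
theorem relDet_le_exp {k : ℕ} {a : Fin k → ℝ} (ha : IsSpectrum a)
    {W : Matrix (Fin k) (Fin k) ℂ} (hW : W.PosSemidef) :
    relDet a W ≤ Real.exp (∑ i, a i * (W i i).re - ∑ i, a i) := by
  rw [← sum_delta_mul_trace, Real.exp_sum, relDet]
  refine Finset.prod_le_prod (fun j _ => Real.rpow_nonneg (det_leadingBlock hW j).1 _)
    fun j _ => ?_
  have h := re_det_le_exp (PosSemidef.leadingBlock hW j)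
  rw [Fintype.card_fin, Nat.cast_add, Nat.cast_one] at h
  calc _ ≤ _ := Real.rpow_le_rpow (det_leadingBlock hW j).1 h (ha.delta_nonneg j)
    _ = _ := by rw [← Real.exp_mul, mul_comm]

/-! ### Stability of the equality case. -/

/-- This is `log √x ≤ √x - 1`, doubled and rearranged. -/
theorem sq_sqrt_sub_one_le {x : ℝ} (hx : 0 < x) :
    (Real.sqrt x - 1) ^ 2 ≤ x - 1 - Real.log x := by
  have h1 := Real.log_le_sub_one_of_pos (Real.sqrt_pos.2 hx)
  rw [Real.log_sqrt hx.le] at h1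
  have h2 := Real.sq_sqrt hx.le
  nlinarith

/-- A defect of at most one forces `√x ≤ 2`, and the `9` is a bound for `(√x + 1) ^ 2`. -/
theorem sq_sub_one_le {x : ℝ} (hx : 0 < x) (h : x - 1 - Real.log x ≤ 1) :
    (x - 1) ^ 2 ≤ 9 * (x - 1 - Real.log x) := by
  have h1 := sq_sqrt_sub_one_le hx
  have h2 := Real.sq_sqrt hx.le
  have h0 := Real.sqrt_nonneg x
  have h3 : Real.sqrt x ≤ 2 := by nlinarith
  have h4 : (x - 1) ^ 2 = (Real.sqrt x - 1) ^ 2 * (Real.sqrt x + 1) ^ 2 := by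
    nth_rewrite 1 [← h2]
    ring
  have h5 : (Real.sqrt x + 1) ^ 2 ≤ 9 := by nlinarith
  rw [h4]
  calc _ ≤ (Real.sqrt x - 1) ^ 2 * 9 := by gcongr
    _ ≤ _ := by linarith

theorem ofReal_sum_normSq {k l : Type*} [Fintype k] [Fintype l] (X : Matrix k l ℂ) :
    ((∑ i, ∑ j, Complex.normSq (X i j) : ℝ) : ℂ) = (X * Xᴴ).trace := by
  simp [trace, mul_apply, Complex.mul_conj]

theorem sum_normSq_sub_one {k : Type*} [Fintype k] [DecidableEq k] {W : Matrix k k ℂ}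
    (hW : W.PosSemidef) :
    ∑ i, ∑ j, Complex.normSq ((W - 1) i j) = ∑ i, (hW.1.eigenvalues i - 1) ^ 2 := by
  have h := hW.1.spectral_theorem
  rw [Unitary.conjStarAlgAut_apply] at h
  set U := hW.1.eigenvectorUnitary
  set D : Matrix k k ℂ := diagonal fun i => ((hW.1.eigenvalues i - 1 : ℝ) : ℂ)
  have h1 : W - 1 = (U : Matrix k k ℂ) * D * (star U : Matrix k k ℂ) := by
    have : D = diagonal (RCLike.ofReal ∘ hW.1.eigenvalues) - 1 := by
      rw [← diagonal_one, diagonal_sub]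
      simp [D, Function.comp]
    rw [this, Matrix.mul_sub, Matrix.sub_mul, Matrix.mul_one, ← Unitary.coe_star,
      Unitary.coe_mul_star_self, Unitary.coe_star, ← h]
  have h2 : ((∑ i, ∑ j, Complex.normSq ((W - 1) i j) : ℝ) : ℂ) =
      ((W - 1) * (W - 1)ᴴ).trace := ofReal_sum_normSq _
  apply Complex.ofReal_injective
  rw [h2, h1]
  have h3 : (star (U : Matrix k k ℂ)) * U = 1 := by simp
  have h4 : (U : Matrix k k ℂ) * D * star (U : Matrix k k ℂ) *
      ((U : Matrix k k ℂ) * D * star (U : Matrix k k ℂ))ᴴ =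
      (U : Matrix k k ℂ) * (D * Dᴴ) * star (U : Matrix k k ℂ) := by
    rw [← star_eq_conjTranspose, star_mul, star_mul, star_star]
    calc _ = (U : Matrix k k ℂ) * D * (star (U : Matrix k k ℂ) * U) * star D *
        star (U : Matrix k k ℂ) := by simp only [Matrix.mul_assoc]
      _ = _ := by rw [h3, Matrix.mul_one]; simp only [Matrix.mul_assoc]; rfl
  rw [h4, trace_mul_cycle, h3, Matrix.one_mul, diagonal_conjTranspose, diagonal_mul_diagonal,
    trace_diagonal]
  simp [sq]

/-- The defect of the trace–determinant inequality is the sum of the nonnegative terms `λ - 1 - log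
λ` over the eigenvalues, each of which controls `(λ - 1) ^ 2`. -/
theorem sum_normSq_sub_one_le {k : Type*} [Fintype k] [DecidableEq k] {W : Matrix k k ℂ}
    (hW : W.PosSemidef) (hpos : 0 < W.det.re) {t : ℝ} (ht : t ≤ 1)
    (h : W.trace.re - Fintype.card k - Real.log W.det.re ≤ t) :
    ∑ i, ∑ j, Complex.normSq ((W - 1) i j) ≤ 9 * t := by
  rw [sum_normSq_sub_one hW]
  rw [PosSemidef.re_det_eq hW] at hpos h
  rw [PosSemidef.re_trace_eq hW] at h
  have hp : ∀ i, 0 < hW.1.eigenvalues i := fun i =>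
    lt_of_le_of_ne (hW.eigenvalues_nonneg i)
      (Ne.symm (Finset.prod_ne_zero_iff.1 hpos.ne' i (Finset.mem_univ _)))
  rw [Real.log_prod fun i _ => (hp i).ne'] at h
  have hs : ∑ i, (hW.1.eigenvalues i - 1 - Real.log (hW.1.eigenvalues i)) ≤ t := by
    simpa [Finset.sum_sub_distrib] using h
  have hnn : ∀ i, 0 ≤ hW.1.eigenvalues i - 1 - Real.log (hW.1.eigenvalues i) := fun i => by
    have := Real.log_le_sub_one_of_pos (hp i)
    linarith
  calc _ ≤ ∑ i, 9 * (hW.1.eigenvalues i - 1 - Real.log (hW.1.eigenvalues i)) := by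
        refine Finset.sum_le_sum fun i _ => sq_sub_one_le (hp i) ?_
        exact ((Finset.single_le_sum (f := fun i => hW.1.eigenvalues i - 1 -
          Real.log (hW.1.eigenvalues i)) (fun i _ => hnn i) (Finset.mem_univ i)).trans hs).trans ht
    _ ≤ _ := by rw [← Finset.mul_sum]; linarith

/-- A minor may vanish only where `Δ a j = 0`; there the factor is `0 ^ 0 = 1` and the logarithmic
term is zero as well. -/
theorem log_relDet {k : ℕ} {a : Fin k → ℝ} {W : Matrix (Fin k) (Fin k) ℂ} (hW : W.PosSemidef)
    (h : 0 < relDet a W) :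
    Real.log (relDet a W) = ∑ j, delta a j * Real.log (leadingBlock W j).det.re := by
  rw [relDet] at h ⊢
  rw [Real.log_prod fun i _ => Finset.prod_ne_zero_iff.1 h.ne' i (Finset.mem_univ _)]
  refine Finset.sum_congr rfl fun j _ => ?_
  rcases eq_or_ne (delta a j) 0 with h0 | h0
  · simp [h0]
  · rw [Real.log_rpow]
    refine lt_of_le_of_ne (det_leadingBlock hW j).1 fun h1 => ?_
    have := Finset.prod_ne_zero_iff.1 h.ne' j (Finset.mem_univ _)
    rw [← h1, Real.zero_rpow h0] at this
    exact this rfl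

theorem det_leadingBlock_pos {k : ℕ} {a : Fin k → ℝ} {W : Matrix (Fin k) (Fin k) ℂ}
    (hW : W.PosSemidef) (h : 0 < relDet a W) (j : Fin k) (hj : delta a j ≠ 0) :
    0 < (leadingBlock W j).det.re := by
  refine lt_of_le_of_ne (det_leadingBlock hW j).1 fun h1 => ?_
  have := Finset.prod_ne_zero_iff.1 h.ne' j (Finset.mem_univ _)
  rw [← h1, Real.zero_rpow hj] at this
  exact this rfl

/-- The `Δ a`-weighted block defects are nonnegative and sum to at most `η`, so block `j` has defect
at most `η / Δ a j`. The hypothesis `hη` makes this at most one, as the stability estimate requires.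
-/
theorem delta_mul_normSq_le {k : ℕ} {a : Fin k → ℝ} (ha : IsSpectrum a) {η : ℝ}
    (hη : ∀ j, 0 < delta a j → η ≤ delta a j) {W : Matrix (Fin k) (Fin k) ℂ}
    (hη0 : 0 ≤ η) (hW : W.PosSemidef) (htr : ∑ i, a i * (W i i).re ≤ ∑ i, a i)
    (hdet : Real.exp (-η) ≤ relDet a W) (j i l : Fin k) (hi : i ≤ j) (hl : l ≤ j) :
    delta a j * Complex.normSq ((W - 1) i l) ≤ 9 * η := by
  rcases (ha.delta_nonneg j).eq_or_lt' with h0 | h0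
  · rw [h0]
    linarith
  have hpos : 0 < relDet a W := (Real.exp_pos _).trans_le hdet
  have hlog : -η ≤ Real.log (relDet a W) := (Real.le_log_iff_exp_le hpos).2 hdet
  rw [log_relDet hW hpos] at hlog
  have hsum : ∑ j, delta a j * ((leadingBlock W j).trace.re - (((j : ℕ) : ℝ) + 1) -
      Real.log (leadingBlock W j).det.re) ≤ η := by
    have := sum_delta_mul_trace a W
    simp only [mul_sub _ (_ - _) (Real.log _), Finset.sum_sub_distrib, this]
    linarith
  have hnn : ∀ j, 0 ≤ delta a j * ((leadingBlock W j).trace.re - (((j : ℕ) : ℝ) + 1) -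
      Real.log (leadingBlock W j).det.re) := by
    intro j
    rcases (ha.delta_nonneg j).eq_or_lt' with h0 | h0
    · simp [h0]
    · refine mul_nonneg h0.le ?_
      have h1 := re_det_le_exp (PosSemidef.leadingBlock hW j)
      rw [← Real.log_le_iff_le_exp (det_leadingBlock_pos hW hpos j h0.ne')] at h1
      simpa using h1
  have hj := (Finset.single_le_sum (fun i _ => hnn i) (Finset.mem_univ j)).trans hsum
  have hj' : (leadingBlock W j).trace.re - (((j : ℕ) : ℝ) + 1) -
      Real.log (leadingBlock W j).det.re ≤ η / delta a j := by
    rw [le_div_iff₀ h0]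
    linarith
  have h3 := sum_normSq_sub_one_le (PosSemidef.leadingBlock hW j)
    (det_leadingBlock_pos hW hpos j h0.ne') (t := η / delta a j)
    ((div_le_one h0).2 (hη j h0)) (by simpa using hj')
  have h4 : Complex.normSq ((W - 1) i l) ≤
      ∑ i, ∑ l, Complex.normSq ((leadingBlock W j - 1) i l) := by
    have e : (W - 1) i l = (leadingBlock W j - 1) ⟨i, Nat.lt_succ_of_le hi⟩
        ⟨l, Nat.lt_succ_of_le hl⟩ := by
      rw [← leadingBlock_one]
      rfl
    rw [e]
    refine (Finset.single_le_sum (f := fun l => Complex.normSq ((leadingBlock W j - 1)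
      ⟨i, Nat.lt_succ_of_le hi⟩ l)) (fun _ _ => Complex.normSq_nonneg _)
      (Finset.mem_univ _)).trans ?_
    exact Finset.single_le_sum (f := fun i => ∑ l, Complex.normSq ((leadingBlock W j - 1) i l))
      (fun _ _ => Finset.sum_nonneg fun _ _ => Complex.normSq_nonneg _) (Finset.mem_univ _)
  calc _ ≤ delta a j * (9 * (η / delta a j)) := by
        gcongr
        exact h4.trans h3
    _ = _ := by field_simp

theorem mul_normSq_le {k : ℕ} {a : Fin k → ℝ} (ha : IsSpectrum a) {η : ℝ}
    (hη : ∀ j, 0 < delta a j → η ≤ delta a j) {W : Matrix (Fin k) (Fin k) ℂ}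
    (hη0 : 0 ≤ η) (hW : W.PosSemidef) (htr : ∑ i, a i * (W i i).re ≤ ∑ i, a i)
    (hdet : Real.exp (-η) ≤ relDet a W) (i l : Fin k) :
    a i * a l * Complex.normSq ((W - 1) i l) ≤ (∑ i, a i) * (k * (9 * η)) := by
  -- Here `t` is the larger and `s` the smaller of `i`, `l`. The blocks containing the entry `(i,
  -- l)` are those with `j ≥ t`, and their weights `Δ a j` add up to `a t`; the factor `a s` is
  -- bounded by the full sum.
  have key : ∀ t s : Fin k, (∀ j, t ≤ j → i ≤ j ∧ l ≤ j) →
      a s * (a t * Complex.normSq ((W - 1) i l)) ≤ (∑ i, a i) * (k * (9 * η)) := by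
    intro t s h
    refine mul_le_mul (Finset.single_le_sum (fun i _ => ha.2 i) (Finset.mem_univ s)) ?_
      (mul_nonneg (ha.2 t) (Complex.normSq_nonneg _)) (Finset.sum_nonneg fun i _ => ha.2 i)
    rw [← sum_delta_of_le a t, Finset.sum_mul]
    calc _ ≤ ∑ _j : Fin k, 9 * η := by
          refine Finset.sum_le_sum fun j _ => ?_
          split_ifs with hj
          · rw [mul_one]
            exact delta_mul_normSq_le ha hη hη0 hW htr hdet j i l (h j hj).1 (h j hj).2
          · simpa using hη0
      _ = _ := by simp
  rcases le_total i l with h | h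
  · have := key l i fun j hj => ⟨h.trans hj, hj⟩
    linarith
  · have := key i l fun j hj => ⟨hj, h.trans hj⟩
    linarith

theorem frobNorm_sq {k : ℕ} (X : Matrix (Fin k) (Fin k) ℂ) :
    (X * Xᴴ).trace.re = ∑ i, ∑ j, Complex.normSq (X i j) := by
  simp [trace, mul_apply, Complex.mul_conj]

/-- If `W` satisfies the trace bound and its relative determinant is almost maximal, then
`√a W √a` is close to `a`. -/
theorem exists_frobNorm_le {k : ℕ} {a : Fin k → ℝ} (ha : IsSpectrum a) {ε : ℝ} (hε : 0 < ε) :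
    ∃ η, 0 < η ∧ ∀ W : Matrix (Fin k) (Fin k) ℂ, W.PosSemidef →
      ∑ i, a i * (W i i).re ≤ ∑ i, a i → Real.exp (-η) ≤ relDet a W →
      frobNorm (diagC a - diagC (fun i => Real.sqrt (a i)) * W *
        diagC (fun i => Real.sqrt (a i))) ≤ ε := by
  set S := ∑ i, a i with hS
  have hS0 : 0 ≤ S := Finset.sum_nonneg fun i _ => ha.2 i
  have hC : 0 < (k * (k * (S * (k * 9))) + 1 : ℝ) := by positivity
  have hmin : ∃ η₁ > 0, ∀ j, 0 < delta a j → η₁ ≤ delta a j := by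
    have : ∀ j, ∃ t > 0, 0 < delta a j → t ≤ delta a j := fun j => by
      by_cases h : 0 < delta a j
      · exact ⟨_, h, fun _ => le_rfl⟩
      · exact ⟨1, one_pos, fun h' => absurd h' h⟩
    choose t ht ht' using this
    rcases isEmpty_or_nonempty (Fin k) with hk | hk
    · exact ⟨1, one_pos, fun j => hk.elim j⟩
    · obtain ⟨j₀, hj₀⟩ := Finite.exists_min t
      exact ⟨t j₀, ht j₀, fun j hj => (hj₀ j).trans (ht' j hj)⟩
  obtain ⟨η₁, hη₁, hη₁'⟩ := hmin
  -- The least positive `Δ a` keeps all relevant block defects below one. The second bound divides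
  -- `ε ^ 2` by the total of the `k * k` entrywise estimates, with `1` added to avoid a zero
  -- denominator.
  refine ⟨min η₁ (ε ^ 2 / (k * (k * (S * (k * 9))) + 1)), lt_min hη₁ (by positivity),
    fun W hW htr hdet => ?_⟩
  set η := min η₁ (ε ^ 2 / (k * (k * (S * (k * 9))) + 1)) with hηd
  have hη0 : 0 ≤ η := le_min hη₁.le (by positivity)
  have h := mul_normSq_le ha (fun j hj => (min_le_left _ _).trans (hη₁' j hj)) hη0 hW htr hdet
  rw [frobNorm, frobNorm_sq]
  refine Real.sqrt_le_iff.2 ⟨hε.le, ?_⟩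
  have he : ∀ i j, Complex.normSq ((diagC a - diagC (fun i => Real.sqrt (a i)) * W *
        diagC (fun i => Real.sqrt (a i))) i j) = a i * a j * Complex.normSq ((W - 1) i j) := by
    intro i j
    have : (diagC a - diagC (fun i => Real.sqrt (a i)) * W *
        diagC (fun i => Real.sqrt (a i))) i j =
        -((Real.sqrt (a i) : ℂ) * (Real.sqrt (a j) : ℂ) * (W - 1) i j) := by
      simp only [diagC, Matrix.sub_apply, diagonal_mul, mul_diagonal]
      rcases eq_or_ne i j with rfl | hij
      · have : (a i : ℂ) = (Real.sqrt (a i) : ℂ) * (Real.sqrt (a i) : ℂ) := by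
          rw [← Complex.ofReal_mul, Real.mul_self_sqrt (ha.2 i)]
        rw [diagonal_apply_eq, one_apply_eq, this]
        ring
      · rw [diagonal_apply_ne _ hij, one_apply_ne hij]
        ring
    rw [this, Complex.normSq_neg, Complex.normSq_mul, Complex.normSq_mul, Complex.normSq_ofReal,
      Complex.normSq_ofReal, Real.mul_self_sqrt (ha.2 i), Real.mul_self_sqrt (ha.2 j)]
  simp only [he]
  calc _ ≤ ∑ _i : Fin k, ∑ _j : Fin k, S * (k * (9 * η)) :=
        Finset.sum_le_sum fun i _ => Finset.sum_le_sum fun j _ => h i j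
    _ = k * (k * (S * (k * 9))) * η := by simp; ring
    _ ≤ (k * (k * (S * (k * 9))) + 1) * η := by nlinarith
    _ ≤ _ := by
      rw [← le_div_iff₀' hC]
      exact min_le_right _ _

/-! ### The completely positive map, its dual and diagonal matrices. -/

section

variable {m n r : ℕ} (A : Fin r → Matrix (Fin m) (Fin n) ℂ)

theorem krausMap_posSemidef {X : Matrix (Fin n) (Fin n) ℂ} (hX : X.PosSemidef) :
    (krausMap A X).PosSemidef :=
  posSemidef_sum _ fun i _ => hX.mul_mul_conjTranspose_same (A i)

theorem krausMap_smul (c : ℂ) (X : Matrix (Fin n) (Fin n) ℂ) :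
    krausMap A (c • X) = c • krausMap A X := by
  simp [krausMap, Finset.smul_sum]

theorem krausMap_sub (X Y : Matrix (Fin n) (Fin n) ℂ) :
    krausMap A (X - Y) = krausMap A X - krausMap A Y := by
  simp [krausMap, Matrix.mul_sub, Matrix.sub_mul]

theorem continuous_krausMap : Continuous (krausMap A) := by
  unfold krausMap
  fun_prop

theorem trace_mul_krausMap (X : Matrix (Fin n) (Fin n) ℂ) (Y : Matrix (Fin m) (Fin m) ℂ) :
    (Y * krausMap A X).trace = (krausMap (dualKraus A) Y * X).trace := by
  simp only [krausMap, dualKraus, Matrix.sum_mul, Matrix.mul_sum, trace_sum,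
    conjTranspose_conjTranspose]
  refine Finset.sum_congr rfl fun i _ => ?_
  rw [← Matrix.mul_assoc, ← Matrix.mul_assoc, trace_mul_comm, Matrix.mul_assoc, Matrix.mul_assoc,
    Matrix.mul_assoc]

theorem dualKraus_scaleKraus (g : GL (Fin m) ℂ) (h : GL (Fin n) ℂ) :
    dualKraus (scaleKraus g h A) = scaleKraus h g (dualKraus A) := by
  funext i
  simp [dualKraus, scaleKraus, Matrix.mul_assoc]

end

theorem diagC_posSemidef {k : ℕ} {a : Fin k → ℝ} (ha : ∀ i, 0 ≤ a i) :
    (diagC a).PosSemidef :=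
  PosSemidef.diagonal fun i => by simpa using ha i

theorem diagC_conjTranspose {k : ℕ} (a : Fin k → ℝ) : (diagC a)ᴴ = diagC a := by
  rw [diagC, diagonal_conjTranspose]
  congr 1
  ext i
  simp

theorem diagC_mul {k : ℕ} (a b : Fin k → ℝ) : diagC a * diagC b = diagC fun i => a i * b i := by
  simp [diagC, diagonal_mul_diagonal]

theorem re_trace_diagC_mul {k : ℕ} (a : Fin k → ℝ) (W : Matrix (Fin k) (Fin k) ℂ) :
    (diagC a * W).trace.re = ∑ i, a i * (W i i).re := by
  simp [diagC, trace, diagonal_mul]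

/-- The invertible diagonal matrix with the given nonzero real entries. -/
noncomputable def diagGL {k : ℕ} (a : Fin k → ℝ) (ha : ∀ i, a i ≠ 0) : GL (Fin k) ℂ where
  val := diagC a
  inv := diagC fun i => (a i)⁻¹
  val_inv := by
    rw [diagC_mul]
    simp [ha, diagC]
  inv_val := by
    rw [diagC_mul]
    simp [ha, diagC]

theorem diagGL_mem_upperGL {k : ℕ} (a : Fin k → ℝ) (ha : ∀ i, a i ≠ 0) :
    diagGL a ha ∈ upperGL k :=
  blockTriangular_diagonal _

theorem relDet_smul {k : ℕ} (a : Fin k → ℝ) {X : Matrix (Fin k) (Fin k) ℂ} (hX : X.PosSemidef)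
    {c : ℝ} (hc : 0 < c) : relDet a ((c : ℂ) • X) = c ^ (∑ i, a i) * relDet a X := by
  rw [← sum_delta_mul_card, Real.rpow_sum_of_pos hc, relDet, relDet, ← Finset.prod_mul_distrib]
  refine Finset.prod_congr rfl fun j _ => ?_
  have h : leadingBlock ((c : ℂ) • X) j = (c : ℂ) • leadingBlock X j := rfl
  rw [h, det_smul, Fintype.card_fin, ← Complex.ofReal_pow, Complex.re_ofReal_mul,
    Real.mul_rpow (by positivity) (det_leadingBlock hX j).1, ← Real.rpow_natCast,
    ← Real.rpow_mul hc.le, mul_comm (delta a j)]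
  push_cast
  rfl

/-! ### From positive capacity to scalability. -/

section

variable {m n r : ℕ} {A : Fin r → Matrix (Fin m) (Fin n) ℂ} {p : Fin n → ℝ} {q : Fin m → ℝ}

theorem conj_diagC_posSemidef (hp : IsSpectrum p) (h : Matrix (Fin n) (Fin n) ℂ) :
    (h * diagC p * hᴴ).PosSemidef :=
  (diagC_posSemidef hp.2).mul_mul_conjTranspose_same h

theorem capacity_le (hp : IsSpectrum p) {h : GL (Fin n) ℂ} (hh : h ∈ upperGL n) :
    capacity A p q ≤ relDet q (krausMap A (h.val * diagC p * h.valᴴ)) /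
      relDet p (h.valᴴ * h.val) := by
  refine ciInf_le ⟨0, ?_⟩ (⟨h, hh⟩ : upperGL n)
  rintro _ ⟨h, rfl⟩
  exact div_nonneg (relDet_nonneg _ (krausMap_posSemidef A (conj_diagC_posSemidef hp _)))
    (relDet_upper_pos p h.2).le

theorem capacity_mul_le (hp : IsSpectrum p) {h : GL (Fin n) ℂ} (hh : h ∈ upperGL n) :
    capacity A p q * relDet p (h.valᴴ * h.val) ≤
      relDet q (krausMap A (h.val * diagC p * h.valᴴ)) :=
  (le_div_iff₀ (relDet_upper_pos p hh)).1 (capacity_le hp hh)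

/-- On the scalar matrix `e^(s/2)` the quotient is a constant times `exp (s * (∑ q - ∑ p))`, which
tends to zero in one direction of `s` unless the sums agree. -/
theorem sum_eq_of_capacity_pos (hp : IsSpectrum p) (hcap : 0 < capacity A p q) :
    ∑ j, p j = ∑ i, q i := by
  set κ := capacity A p q
  set N := relDet q (krausMap A (diagC p))
  have key : ∀ s : ℝ, κ * Real.exp (s * (∑ j, p j - ∑ i, q i)) ≤ N := by
    intro s
    set c := Real.exp (s / 2)
    have hc : c * c = Real.exp s := by
      rw [← Real.exp_add]
      ring_nf
    have h := capacity_mul_le (A := A) (q := q) hp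
      (diagGL_mem_upperGL (fun _ : Fin n => c) fun _ => (Real.exp_pos _).ne')
    have e1 : (diagGL (fun _ : Fin n => c) fun _ => (Real.exp_pos _).ne').val =
        (c : ℂ) • (1 : Matrix (Fin n) (Fin n) ℂ) := by
      change diagC (fun _ => c) = _
      rw [diagC, smul_one_eq_diagonal]
    rw [e1, conjTranspose_smul, conjTranspose_one, Complex.star_def, Complex.conj_ofReal,
      smul_mul_assoc, Matrix.one_mul, smul_mul_assoc, Matrix.mul_smul, Matrix.mul_one, smul_smul,
      ← Complex.ofReal_mul, Matrix.one_mul, smul_smul, ← Complex.ofReal_mul, hc,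
      krausMap_smul, relDet_smul _ PosSemidef.one (Real.exp_pos _), relDet_one, mul_one,
      relDet_smul _ (krausMap_posSemidef A (diagC_posSemidef hp.2)) (Real.exp_pos _),
      ← Real.exp_mul, ← Real.exp_mul] at h
    rw [mul_sub, Real.exp_sub, ← mul_div_assoc, div_le_iff₀ (Real.exp_pos _), mul_comm N]
    exact h
  by_contra hne
  have hd : ∑ j, p j - ∑ i, q i ≠ 0 := sub_ne_zero.2 hne
  -- This `s` makes the exponent `N / κ`, and `κ * (N / κ + 1) = N + κ` exceeds `N`.
  have h := key (N / κ / (∑ j, p j - ∑ i, q i))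
  rw [div_mul_cancel₀ _ hd] at h
  have h1 := mul_le_mul_of_nonneg_left (Real.add_one_le_exp (N / κ)) hcap.le
  rw [mul_add, mul_div_cancel₀ _ hcap.ne'] at h1
  linarith

/-- Duality and cyclicity of the trace; a trace bound for the scaled map thus passes to the scaled
dual and back. -/
theorem trace_scaled (X : Matrix (Fin n) (Fin n) ℂ) (g : Matrix (Fin m) (Fin m) ℂ)
    (h : Matrix (Fin n) (Fin n) ℂ) (Q : Matrix (Fin m) (Fin m) ℂ) :
    (Q * (gᴴ * krausMap A (h * X * hᴴ) * g)).trace =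
      (X * (hᴴ * krausMap (dualKraus A) (g * Q * gᴴ) * h)).trace := by
  have h1 : (Q * (gᴴ * krausMap A (h * X * hᴴ) * g)).trace =
      (g * Q * gᴴ * krausMap A (h * X * hᴴ)).trace := by
    rw [← Matrix.mul_assoc, trace_mul_comm]
    simp only [Matrix.mul_assoc]
  have h2 : (X * (hᴴ * krausMap (dualKraus A) (g * Q * gᴴ) * h)).trace =
      (krausMap (dualKraus A) (g * Q * gᴴ) * (h * X * hᴴ)).trace := by
    rw [trace_mul_comm, Matrix.mul_assoc, Matrix.mul_assoc, trace_mul_comm]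
    simp only [Matrix.mul_assoc]
  rw [h1, h2, trace_mul_krausMap]

/-- The matrix `h` is nearly optimal and `g` normalizes `T(h P h†)`, which gives the first pair of
bounds. For the second, let `k` normalize the scaled dual `Z`: a small `relDet p Z` would mean a
large `relDet p (k† k)`, and then `h * k` would have a quotient below the capacity. -/
theorem exists_relDet_near (hp : IsSpectrum p) (hq : IsSpectrum q) (hcap : 0 < capacity A p q)
    {η : ℝ} (hη : 0 < η) : ∃ g ∈ upperGL m, ∃ h ∈ upperGL n,
      (∑ i, q i * ((g.valᴴ * krausMap A (h.val * diagC p * h.valᴴ) * g.val) i i).re ≤ ∑ i, q i ∧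
        Real.exp (-η) ≤ relDet q (g.valᴴ * krausMap A (h.val * diagC p * h.valᴴ) * g.val)) ∧
      (∑ j, p j * ((h.valᴴ * krausMap (dualKraus A) (g.val * diagC q * g.valᴴ) * h.val) j j).re ≤
          ∑ j, p j ∧
        Real.exp (-(2 * η)) ≤
          relDet p (h.valᴴ * krausMap (dualKraus A) (g.val * diagC q * g.valᴴ) * h.val)) := by
  have hsum := sum_eq_of_capacity_pos hp hcap
  set κ := capacity A p q with hκ
  have hlt : κ < κ * Real.exp η := by
    have := Real.add_one_le_exp η
    nlinarith
  have : Nonempty (upperGL n) := ⟨⟨1, one_mem_upperGL n⟩⟩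
  obtain ⟨⟨h, hh⟩, hh1⟩ := exists_lt_of_ciInf_lt (hκ ▸ hlt)
  have hD := relDet_upper_pos p hh
  simp only at hh1
  rw [div_lt_iff₀ hD] at hh1
  set Y := krausMap A (h.val * diagC p * h.valᴴ) with hY
  have hYp : Y.PosSemidef := krausMap_posSemidef A (conj_diagC_posSemidef hp _)
  have hN : 0 < relDet q Y := (mul_pos hcap hD).trans_le (capacity_mul_le hp hh)
  -- Only the minors with `Δ q ≠ 0` are known to be nonzero, so `Y` may be singular; the Cholesky
  -- factor is taken for a perturbation costing at most a factor `exp η`.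
  obtain ⟨δ, hδ, hδN⟩ : ∃ δ : ℝ, 0 < δ ∧
      relDet q (Y + (δ : ℂ) • (1 : Matrix (Fin m) (Fin m) ℂ)) < relDet q Y * Real.exp η := by
    have hc : Continuous fun δ : ℝ => relDet q (Y + (δ : ℂ) • (1 : Matrix (Fin m) (Fin m) ℂ)) :=
      (continuous_relDet hq).comp (by fun_prop)
    have h0 : relDet q (Y + ((0 : ℝ) : ℂ) • (1 : Matrix (Fin m) (Fin m) ℂ)) <
        relDet q Y * Real.exp η := by
      have := Real.add_one_le_exp η
      simp only [Complex.ofReal_zero, zero_smul, add_zero]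
      nlinarith
    have hev := (hc.continuousAt.eventually_lt continuousAt_const h0).filter_mono
      (nhdsWithin_le_nhds (s := Set.Ioi (0 : ℝ)))
    obtain ⟨δ, hδ1, hδ2⟩ := (hev.and self_mem_nhdsWithin).exists
    exact ⟨δ, hδ2, hδ1⟩
  set Y' := Y + (δ : ℂ) • (1 : Matrix (Fin m) (Fin m) ℂ) with hY'
  have hY'p : Y'.PosDef := posDef_add_smul_one hYp hδ
  obtain ⟨g, hg, hg1⟩ := exists_upperGL_conj_eq_one hY'p
  have hgD : relDet q (g.valᴴ * g.val) * relDet q Y' = 1 := by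
    rw [← relDet_upper_conj q hY'p.posSemidef hg, hg1, relDet_one]
  have hgpos := relDet_upper_pos q hg
  have hWle : ∀ i, ((g.valᴴ * Y * g.val) i i).re ≤ 1 := by
    intro i
    have e : g.valᴴ * Y * g.val + (δ : ℂ) • (g.valᴴ * g.val) = 1 := by
      rw [← hg1, hY', Matrix.mul_add, Matrix.add_mul]
      simp
    have := congrArg (fun M : Matrix (Fin m) (Fin m) ℂ => (M i i).re) e
    simp only [Matrix.add_apply, Matrix.smul_apply, smul_eq_mul, Complex.add_re,
      Complex.re_ofReal_mul, one_apply_eq, Complex.one_re] at this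
    have h2 := (Complex.le_def.1 ((posSemidef_conjTranspose_mul_self g.val).diag_nonneg (i := i))).1
    rw [Complex.zero_re] at h2
    nlinarith
  have hW1 : ∑ i, q i * ((g.valᴴ * Y * g.val) i i).re ≤ ∑ i, q i :=
    Finset.sum_le_sum fun i _ => mul_le_of_le_one_right (hq.2 i) (hWle i)
  refine ⟨g, hg, h, hh, ⟨hW1, ?_⟩, ?_, ?_⟩
  · rw [relDet_upper_conj q hYp hg]
    have : relDet q (g.valᴴ * g.val) * relDet q Y * Real.exp η ≥ 1 := by
      rw [← hgD, mul_assoc]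
      exact mul_le_mul_of_nonneg_left hδN.le hgpos.le
    rwa [Real.exp_neg, inv_le_iff_one_le_mul₀ (Real.exp_pos _)]
  · rw [← re_trace_diagC_mul, ← trace_scaled, re_trace_diagC_mul, hsum]
    exact hW1
  set Z := h.valᴴ * krausMap (dualKraus A) (g.val * diagC q * g.valᴴ) * h.val with hZ
  have hZp : Z.PosSemidef :=
    (krausMap_posSemidef _ (conj_diagC_posSemidef hq _)).conjTranspose_mul_mul_same _
  have hcont : Continuous fun δ : ℝ => relDet p (Z + (δ : ℂ) • (1 : Matrix (Fin n) (Fin n) ℂ)) :=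
    (continuous_relDet hp).comp (by fun_prop)
  -- `Z` may be singular too: the bound is proved for `Z + δ` and passed to the limit.
  suffices hδ : ∀ δ : ℝ, 0 < δ → Real.exp (-(2 * η)) ≤
      relDet p (Z + (δ : ℂ) • (1 : Matrix (Fin n) (Fin n) ℂ)) by
    have := ge_of_tendsto (hcont.continuousWithinAt (s := Set.Ioi (0 : ℝ)) (x := 0))
      (b := Real.exp (-(2 * η))) (Filter.eventually_of_mem self_mem_nhdsWithin hδ)
    simpa using this
  intro δ' hδ'
  have hZ'p := posDef_add_smul_one hZp hδ'
  set Z' := Z + (δ' : ℂ) • (1 : Matrix (Fin n) (Fin n) ℂ) with hZ'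
  obtain ⟨k, hk, hk1⟩ := exists_upperGL_conj_eq_one hZ'p
  have hkD : relDet p (k.valᴴ * k.val) * relDet p Z' = 1 := by
    rw [← relDet_upper_conj p hZ'p.posSemidef hk, hk1, relDet_one]
  have hkpos := relDet_upper_pos p hk
  set X := krausMap A ((h * k).val * diagC p * (h * k).valᴴ) with hX
  have hXp : X.PosSemidef := krausMap_posSemidef A (conj_diagC_posSemidef hp _)
  have hcapk := capacity_mul_le (A := A) (q := q) hp (mul_mem_upperGL hh hk)
  rw [relDet_upper_mul p hk, ← hX] at hcapk
  have hZle : ∀ j, ((k.valᴴ * Z * k.val) j j).re ≤ 1 := by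
    intro i
    have e : k.valᴴ * Z * k.val + (δ' : ℂ) • (k.valᴴ * k.val) = 1 := by
      rw [← hk1, hZ', Matrix.mul_add, Matrix.add_mul]
      simp
    have := congrArg (fun M : Matrix (Fin n) (Fin n) ℂ => (M i i).re) e
    simp only [Matrix.add_apply, Matrix.smul_apply, smul_eq_mul, Complex.add_re,
      Complex.re_ofReal_mul, one_apply_eq, Complex.one_re] at this
    have h2 := (Complex.le_def.1 ((posSemidef_conjTranspose_mul_self k.val).diag_nonneg (i := i))).1
    rw [Complex.zero_re] at h2
    nlinarith
  -- Duality turns `k† Z k ≤ 1` into the trace bound needed to apply AM–GM to `g† X g`.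
  have hXtr : ∑ i, q i * ((g.valᴴ * X * g.val) i i).re ≤ ∑ i, q i := by
    have e : X = krausMap A (h.val * (k.val * diagC p * k.valᴴ) * h.valᴴ) := by
      rw [hX, Units.val_mul, conjTranspose_mul]
      simp only [Matrix.mul_assoc]
    rw [← re_trace_diagC_mul, e, trace_scaled, ← hZ, ← hsum]
    have e2 : (k.val * diagC p * k.valᴴ * Z).trace = (diagC p * (k.valᴴ * Z * k.val)).trace := by
      rw [Matrix.mul_assoc, Matrix.mul_assoc, trace_mul_comm]
      simp only [Matrix.mul_assoc]
    rw [e2, re_trace_diagC_mul]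
    exact Finset.sum_le_sum fun i _ => mul_le_of_le_one_right (hp.2 i) (hZle i)
  have hXdet : relDet q (g.valᴴ * g.val) * relDet q X ≤ 1 := by
    rw [← relDet_upper_conj q hXp hg]
    refine (relDet_le_exp hq (hXp.conjTranspose_mul_mul_same _)).trans ?_
    rw [Real.exp_le_one_iff]
    linarith
  have hXle : relDet q X ≤ relDet q Y' := by
    rw [← hgD] at hXdet
    exact le_of_mul_le_mul_left hXdet hgpos
  -- One `η` comes from the choice of `h`, the other from the perturbation of `Y`.
  have hfin : relDet p (k.valᴴ * k.val) ≤ Real.exp (2 * η) := by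
    have h1 : κ * relDet p (h.valᴴ * h.val) * relDet p (k.valᴴ * k.val) ≤
        κ * relDet p (h.valᴴ * h.val) * Real.exp (2 * η) := by
      calc _ = κ * (relDet p (h.valᴴ * h.val) * relDet p (k.valᴴ * k.val)) := by ring
        _ ≤ relDet q Y' := hcapk.trans hXle
        _ ≤ relDet q Y * Real.exp η := hδN.le
        _ ≤ κ * Real.exp η * relDet p (h.valᴴ * h.val) * Real.exp η := by
          gcongr
        _ = _ := by rw [two_mul, Real.exp_add]; ring
    exact le_of_mul_le_mul_left h1 (mul_pos hcap hD)
  rw [Real.exp_neg, inv_le_iff_one_le_mul₀ (Real.exp_pos _), ← hkD, mul_comm]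
  exact mul_le_mul_of_nonneg_left hfin (relDet_nonneg _ hZ'p.posSemidef)

theorem continuous_frobNorm {k : ℕ} : Continuous (frobNorm (k := k)) := by
  unfold frobNorm
  fun_prop

theorem triangularScalable_of_capacity_pos (hp : IsSpectrum p) (hq : IsSpectrum q)
    (hcap : 0 < capacity A p q) : TriangularScalable A p q := by
  intro ε hε
  obtain ⟨η₁, hη₁, H₁⟩ := exists_frobNorm_le hq (half_pos hε)
  obtain ⟨η₂, hη₂, H₂⟩ := exists_frobNorm_le hp (half_pos hε)
  obtain ⟨g, hg, h, hh, ⟨hW1, hW2⟩, hZ1, hZ2⟩ := exists_relDet_near hp hq hcap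
    (lt_min hη₁ (half_pos hη₂))
  have hW := H₁ _ ((krausMap_posSemidef A (conj_diagC_posSemidef hp _)).conjTranspose_mul_mul_same
    _) hW1 ((Real.exp_le_exp.2 (neg_le_neg (min_le_left _ _))).trans hW2)
  have hZ := H₂ _ ((krausMap_posSemidef (dualKraus A)
    (conj_diagC_posSemidef hq _)).conjTranspose_mul_mul_same _) hZ1
    ((Real.exp_le_exp.2 (neg_le_neg (by linarith [min_le_right η₁ (η₂ / 2)]))).trans hZ2)
  -- At `s = 0` the two marginals are `√Q W √Q` and `√P Z √P`, already within `ε / 2`. Zeros of `p`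
  -- or `q` would make `G 0` or `H 0` singular, so a small `s > 0` is used, by continuity.
  set G : ℝ → Matrix (Fin m) (Fin m) ℂ := fun s => g.val * diagC fun i => Real.sqrt (q i) + s
    with hG
  set H : ℝ → Matrix (Fin n) (Fin n) ℂ := fun s => h.val * diagC fun i => Real.sqrt (p i) + s
    with hH
  have hGc : Continuous G := by
    unfold G diagC
    fun_prop
  have hHc : Continuous H := by
    unfold H diagC
    fun_prop
  have hsq : ∀ {k : ℕ} (a : Fin k → ℝ), IsSpectrum a → ∀ u : Matrix (Fin k) (Fin k) ℂ,
      (u * diagC fun i => Real.sqrt (a i) + 0) * (u * diagC fun i => Real.sqrt (a i) + 0)ᴴ =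
        u * diagC a * uᴴ := by
    intro k a ha u
    rw [conjTranspose_mul, diagC_conjTranspose, Matrix.mul_assoc, ← Matrix.mul_assoc (diagC _),
      diagC_mul, Matrix.mul_assoc]
    simp only [add_zero, Real.mul_self_sqrt (ha.2 _)]
  have e1 : Continuous fun s => frobNorm (diagC q - (G s)ᴴ * krausMap A (H s * (H s)ᴴ) * G s) := by
    refine continuous_frobNorm.comp (continuous_const.sub ?_)
    exact (hGc.matrix_conjTranspose.matrix_mul ((continuous_krausMap A).comp
      (hHc.matrix_mul hHc.matrix_conjTranspose))).matrix_mul hGc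
  have e2 : Continuous fun s => frobNorm (diagC p -
      (H s)ᴴ * krausMap (dualKraus A) (G s * (G s)ᴴ) * H s) := by
    refine continuous_frobNorm.comp (continuous_const.sub ?_)
    exact (hHc.matrix_conjTranspose.matrix_mul ((continuous_krausMap _).comp
      (hGc.matrix_mul hGc.matrix_conjTranspose))).matrix_mul hHc
  have f1 : frobNorm (diagC q - (G 0)ᴴ * krausMap A (H 0 * (H 0)ᴴ) * G 0) < ε := by
    simp only [hG, hH]
    rw [hsq p hp h.val, conjTranspose_mul, diagC_conjTranspose]
    simp only [add_zero, Matrix.mul_assoc] at hW ⊢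
    linarith
  have f2 : frobNorm (diagC p - (H 0)ᴴ * krausMap (dualKraus A) (G 0 * (G 0)ᴴ) * H 0) < ε := by
    simp only [hG, hH]
    rw [hsq q hq g.val, conjTranspose_mul, diagC_conjTranspose]
    simp only [add_zero, Matrix.mul_assoc] at hZ ⊢
    linarith
  have hev := ((e1.continuousAt.eventually_lt continuousAt_const f1).and
    (e2.continuousAt.eventually_lt continuousAt_const f2)).filter_mono
      (nhdsWithin_le_nhds (s := Set.Ioi (0 : ℝ)))
  obtain ⟨s, ⟨hs1, hs2⟩, hs⟩ := (hev.and self_mem_nhdsWithin).exists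
  have hne : ∀ {k : ℕ} (a : Fin k → ℝ) (i : Fin k), Real.sqrt (a i) + s ≠ 0 := fun a i => by
    have := Real.sqrt_nonneg (a i)
    positivity
  refine ⟨g * diagGL _ (hne q), mul_mem_upperGL hg (diagGL_mem_upperGL _ _),
    h * diagGL _ (hne p), mul_mem_upperGL hh (diagGL_mem_upperGL _ _), ?_, ?_⟩
  · rw [krausMap_scaleKraus, Matrix.mul_one]
    exact hs1.le
  · rw [dualKraus_scaleKraus, krausMap_scaleKraus, Matrix.mul_one]
    exact hs2.le

end

/-! ### The standard flag and orthogonal projections. -/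

theorem mem_stdFlag {k : ℕ} {i : Fin k} {x : Fin k → ℂ} :
    x ∈ stdFlag i ↔ ∀ l, i < l → x l = 0 := by
  constructor
  · intro hx l hl
    have hle : stdFlag i ≤ LinearMap.ker (LinearMap.proj l : (Fin k → ℂ) →ₗ[ℂ] ℂ) := by
      refine Submodule.span_le.2 ?_
      rintro _ ⟨j, hj, rfl⟩
      have : l ≠ j := (lt_of_le_of_lt hj hl).ne'
      simp [this]
    simpa using hle hx
  · intro h
    rw [← Finset.univ_sum_single x]
    refine Submodule.sum_mem _ fun l _ => ?_
    rcases le_or_gt l i with hl | hl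
    · have : (Pi.single l (x l) : Fin k → ℂ) = x l • Pi.single l 1 := by
        rw [← Pi.single_smul, smul_eq_mul, mul_one]
      rw [this]
      exact Submodule.smul_mem _ _ (Submodule.subset_span ⟨l, hl, rfl⟩)
    · rw [h l hl, Pi.single_zero]
      exact Submodule.zero_mem _

/-- The matrix `π` is the orthogonal projection onto `L`. -/
structure IsProjOnto {k : ℕ} (π : Matrix (Fin k) (Fin k) ℂ) (L : Submodule ℂ (Fin k → ℂ)) :
    Prop where
  conjTranspose_eq : πᴴ = π
  mul_self : π * π = π
  mulVec_mem : ∀ x, π *ᵥ x ∈ L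
  mulVec_eq : ∀ x ∈ L, π *ᵥ x = x
  trace_eq : π.trace = Module.finrank ℂ L

theorem exists_isProjOnto {k : ℕ} (L : Submodule ℂ (Fin k → ℂ)) : ∃ π, IsProjOnto π L := by
  let e := (WithLp.linearEquiv 2 ℂ (Fin k → ℂ)).symm
  let L' : Submodule ℂ (EuclideanSpace ℂ (Fin k)) := L.map e.toLinearMap
  let b := stdOrthonormalBasis ℂ L'
  let B : Matrix (Fin k) (Fin (Module.finrank ℂ L')) ℂ := of fun i j => (b j : EuclideanSpace ℂ (Fin k)) i
  have hfin : Module.finrank ℂ L' = Module.finrank ℂ L := LinearEquiv.finrank_map_eq e L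
  have hB : Bᴴ * B = 1 := by
    ext i j
    have h := orthonormal_iff_ite.1 b.orthonormal i j
    rw [Submodule.coe_inner, EuclideanSpace.inner_eq_star_dotProduct] at h
    rw [one_apply, ← h, dotProduct_comm]
    rfl
  have hmem : ∀ c, B *ᵥ c ∈ L := by
    intro c
    have h1 : ∀ j, (fun i => B i j) ∈ L := by
      intro j
      obtain ⟨x, hx, hxe⟩ := (b j).2
      have : (fun i => B i j) = x := by
        funext i
        change (b j : EuclideanSpace ℂ (Fin k)) i = x i
        rw [← hxe]
        rfl
      rwa [this]
    have : B *ᵥ c = ∑ j, c j • fun i => B i j := by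
      funext i
      simp [mulVec, dotProduct, mul_comm]
    rw [this]
    exact Submodule.sum_mem _ fun j _ => Submodule.smul_mem _ _ (h1 j)
  have hex : ∀ x ∈ L, ∃ c, x = B *ᵥ c := by
    intro x hx
    have h := b.sum_repr ⟨e x, Submodule.mem_map_of_mem hx⟩
    refine ⟨fun j => b.repr ⟨e x, Submodule.mem_map_of_mem hx⟩ j, ?_⟩
    have h' := congrArg (fun y : L' => (y : EuclideanSpace ℂ (Fin k))) h
    funext i
    have h'' := congrArg (fun y : EuclideanSpace ℂ (Fin k) => y i) h'
    simp only [Submodule.coe_sum, Submodule.coe_smul] at h''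
    rw [WithLp.ofLp_sum, Finset.sum_apply] at h''
    change _ = x i at h''
    rw [← h'', mulVec, dotProduct]
    exact Finset.sum_congr rfl fun j _ => mul_comm _ _
  refine ⟨B * Bᴴ, ?_, ?_, ?_, ?_, ?_⟩
  · simp
  · rw [Matrix.mul_assoc, ← Matrix.mul_assoc Bᴴ, hB, Matrix.one_mul]
  · intro x
    rw [← mulVec_mulVec]
    exact hmem _
  · intro x hx
    obtain ⟨c, rfl⟩ := hex x hx
    rw [mulVec_mulVec, Matrix.mul_assoc, hB, Matrix.mul_one]
  · rw [trace_mul_comm, hB, trace_one, Fintype.card_fin, hfin]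

namespace IsProjOnto

variable {k : ℕ} {π : Matrix (Fin k) (Fin k) ℂ} {L : Submodule ℂ (Fin k → ℂ)}

theorem posSemidef (h : IsProjOnto π L) : π.PosSemidef := by
  have := posSemidef_conjTranspose_mul_self π
  rwa [h.conjTranspose_eq, h.mul_self] at this

theorem one_sub_sq (h : IsProjOnto π L) : (1 - π)ᴴ * (1 - π) = 1 - π := by
  rw [conjTranspose_sub, h.conjTranspose_eq, conjTranspose_one, Matrix.mul_sub, Matrix.sub_mul,
    Matrix.sub_mul, h.mul_self]
  simp

theorem one_sub_posSemidef (h : IsProjOnto π L) : (1 - π).PosSemidef := by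
  have := posSemidef_conjTranspose_mul_self (1 - π)
  rwa [h.one_sub_sq] at this

/-- Row `i` of a projection has squared norm `π i i`, and `1 - π ≥ 0` bounds this by one. -/
theorem norm_apply_le (h : IsProjOnto π L) (i j : Fin k) : ‖π i j‖ ≤ 1 := by
  have h1 : ((∑ l, Complex.normSq (π i l) : ℝ) : ℂ) = π i i := by
    have : (π * πᴴ) i i = π i i := by rw [h.conjTranspose_eq, h.mul_self]
    rw [← this]
    simp [mul_apply, Complex.mul_conj]
  have h2 : Complex.normSq (π i j) ≤ ∑ l, Complex.normSq (π i l) :=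
    Finset.single_le_sum (f := fun l => Complex.normSq (π i l))
      (fun _ _ => Complex.normSq_nonneg _) (Finset.mem_univ j)
  have h3 : ∑ l, Complex.normSq (π i l) ≤ 1 := by
    have h4 := h.one_sub_posSemidef.diag_nonneg (i := i)
    rw [Matrix.sub_apply, one_apply_eq, ← h1, sub_nonneg] at h4
    exact_mod_cast h4
  rw [← Complex.sq_norm] at h2
  nlinarith [norm_nonneg (π i j)]

/-- The projection `σ` onto the intersection satisfies `σ ≤ π`, its trace is the dimension, and its
diagonal vanishes beyond index `i`. -/
theorem finrank_inf_stdFlag_le (h : IsProjOnto π L) (i : Fin k) :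
    (Module.finrank ℂ ↥(stdFlag i ⊓ L) : ℝ) ≤
      ∑ l : Fin ((i : ℕ) + 1), (π (Fin.castLE i.isLt l) (Fin.castLE i.isLt l)).re := by
  obtain ⟨σ, hσ⟩ := exists_isProjOnto (stdFlag i ⊓ L)
  have e1 : π * σ = σ := by
    ext a b
    have := congrFun (h.mulVec_eq _ (hσ.mulVec_mem (Pi.single b 1)).2) a
    rw [mulVec_mulVec] at this
    simpa using this
  have e2 : σ * π = σ := by
    rw [← hσ.conjTranspose_eq, ← h.conjTranspose_eq, ← conjTranspose_mul, e1]
  have hpsd : (π - σ).PosSemidef := by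
    have := posSemidef_conjTranspose_mul_self (π - σ)
    rw [conjTranspose_sub, h.conjTranspose_eq, hσ.conjTranspose_eq, Matrix.mul_sub,
      Matrix.sub_mul, Matrix.sub_mul, e1, e2, h.mul_self, hσ.mul_self] at this
    simpa using this
  have h3 : (Module.finrank ℂ ↥(stdFlag i ⊓ L) : ℝ) =
      ∑ l : Fin ((i : ℕ) + 1), (σ (Fin.castLE i.isLt l) (Fin.castLE i.isLt l)).re := by
    have := congrArg Complex.re hσ.trace_eq
    rw [sum_castLE_of_zero i fun l => (σ l l).re]
    · rw [Complex.natCast_re] at this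
      rw [← this]
      simp [trace]
    · intro l hl
      have := mem_stdFlag.1 (hσ.mulVec_mem (Pi.single l 1)).1 l hl
      simp only [mulVec_single_one, col_apply] at this
      rw [this, Complex.zero_re]
  rw [h3]
  refine Finset.sum_le_sum fun l _ => ?_
  have := (Complex.le_def.1 (hpsd.diag_nonneg (i := Fin.castLE i.isLt l))).1
  rw [Matrix.sub_apply, Complex.sub_re, Complex.zero_re] at this
  linarith

theorem sum_delta_finrank_le {a : Fin k → ℝ} (ha : IsSpectrum a) (h : IsProjOnto π L) :
    ∑ i, delta a i * (Module.finrank ℂ ↥(stdFlag i ⊓ L) : ℝ) ≤ (diagC a * π).trace.re := by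
  rw [re_trace_diagC_mul, ← sum_delta_mul a fun l => (π l l).re]
  exact Finset.sum_le_sum fun i _ =>
    mul_le_mul_of_nonneg_left (h.finrank_inf_stdFlag_le i) (ha.delta_nonneg i)

theorem mul_trace_le {X : Matrix (Fin k) (Fin k) ℂ} {ε : ℝ}
    (hX : frobNorm X ≤ ε) (h : IsProjOnto π L) : |(X * π).trace.re| ≤ k * (k * ε) := by
  have hε : 0 ≤ ε := (Real.sqrt_nonneg _).trans hX
  have hentry : ∀ i j, ‖X i j‖ ≤ ε := by
    intro i j
    rw [frobNorm, frobNorm_sq, Real.sqrt_le_left hε] at hX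
    have h1 : Complex.normSq (X i j) ≤ ∑ i, ∑ j, Complex.normSq (X i j) :=
      (Finset.single_le_sum (f := fun j => Complex.normSq (X i j))
        (fun _ _ => Complex.normSq_nonneg _) (Finset.mem_univ j)).trans
      (Finset.single_le_sum (f := fun i => ∑ j, Complex.normSq (X i j))
        (fun _ _ => Finset.sum_nonneg fun _ _ => Complex.normSq_nonneg _) (Finset.mem_univ i))
    rw [← Complex.sq_norm] at h1
    exact abs_le_of_sq_le_sq' (h1.trans hX) hε |>.2
  refine (Complex.abs_re_le_norm _).trans ?_
  simp only [trace, diag_apply, mul_apply]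
  calc _ ≤ ∑ _i : Fin k, ∑ _j : Fin k, ε := by
        refine (norm_sum_le _ _).trans (Finset.sum_le_sum fun i _ => ?_)
        refine (norm_sum_le _ _).trans (Finset.sum_le_sum fun j _ => ?_)
        rw [norm_mul]
        exact (mul_le_of_le_one_right (norm_nonneg _) (h.norm_apply_le j i)).trans (hentry i j)
    _ = _ := by simp

end IsProjOnto

theorem isProjOnto_top (k : ℕ) : IsProjOnto (1 : Matrix (Fin k) (Fin k) ℂ) ⊤ :=
  ⟨by simp, by simp, by simp, by simp, by simp⟩

/-! ### From scalability to the rank condition. -/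

section

variable {m n r : ℕ} {A : Fin r → Matrix (Fin m) (Fin n) ℂ} {p : Fin n → ℝ} {q : Fin m → ℝ}

theorem trace_krausMap_one : (krausMap A 1).trace = (krausMap (dualKraus A) 1).trace := by
  simpa using trace_mul_krausMap A 1 1

/-- Independence gives `π * A i * ρ = 0`, so `Tr π T(ρ)` drops out when the nonnegative number `Tr
(1 - π) T(1 - ρ)` is expanded. -/
theorem Independent.trace_add_le {L : Submodule ℂ (Fin m → ℂ)} {R : Submodule ℂ (Fin n → ℂ)}
    (h : Independent A L R) {π : Matrix (Fin m) (Fin m) ℂ} {ρ : Matrix (Fin n) (Fin n) ℂ}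
    (hπ : IsProjOnto π L) (hρ : IsProjOnto ρ R) :
    (krausMap A 1 * π).trace.re + (krausMap (dualKraus A) 1 * ρ).trace.re ≤
      (krausMap (dualKraus A) 1).trace.re := by
  have h0 : ∀ i, π * A i * ρ = 0 := by
    intro i
    ext a b
    have h1 := h i _ (hπ.mulVec_mem (Pi.single a 1)) _ (hρ.mulVec_mem (Pi.single b 1))
    have e : star (π *ᵥ Pi.single a 1) = fun c => π a c := by
      funext c
      conv_rhs => rw [← hπ.conjTranspose_eq]
      simp
    rw [e, mulVec_mulVec, mulVec_single_one] at h1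
    rw [Matrix.mul_assoc, Matrix.mul_apply]
    exact h1
  have h1 : π * krausMap A ρ = 0 := by
    simp only [krausMap, Matrix.mul_sum]
    refine Finset.sum_eq_zero fun i _ => ?_
    rw [← Matrix.mul_assoc, ← Matrix.mul_assoc, h0, Matrix.zero_mul]
  have h2 : 0 ≤ ((1 - π) * krausMap A (1 - ρ)).trace.re := by
    have h3 : ((1 - π) * krausMap A (1 - ρ)).trace =
        ((1 - π) * krausMap A (1 - ρ) * (1 - π)ᴴ).trace := by
      conv_lhs => rw [← hπ.one_sub_sq, Matrix.mul_assoc, trace_mul_comm]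
    rw [h3]
    exact (Complex.le_def.1 ((krausMap_posSemidef A
      hρ.one_sub_posSemidef).mul_mul_conjTranspose_same _).trace_nonneg).1
  have h4 : ((1 - π) * krausMap A (1 - ρ)).trace = (krausMap (dualKraus A) 1).trace -
      (krausMap (dualKraus A) 1 * ρ).trace - (krausMap A 1 * π).trace := by
    rw [Matrix.sub_mul, Matrix.one_mul, krausMap_sub, Matrix.mul_sub, h1, sub_zero, trace_sub,
      trace_sub, trace_krausMap_one, trace_mul_comm π, ← trace_mul_krausMap, Matrix.one_mul]
  rw [h4, Complex.sub_re, Complex.sub_re] at h2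
  linarith

theorem Independent.scale {L : Submodule ℂ (Fin m → ℂ)} {R : Submodule ℂ (Fin n → ℂ)}
    (h : Independent A L R) (g : GL (Fin m) ℂ) (k : GL (Fin n) ℂ) :
    Independent (scaleKraus g k A) (L.map (g⁻¹).val.mulVecLin) (R.map (k⁻¹).val.mulVecLin) := by
  rintro i _ ⟨y, hy, rfl⟩ _ ⟨x, hx, rfl⟩
  have hk : k.val * (k⁻¹).val = 1 := by rw [← Units.val_mul, mul_inv_cancel, Units.val_one]
  have hg : g.val * (g⁻¹).val = 1 := by rw [← Units.val_mul, mul_inv_cancel, Units.val_one]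
  have hg' : ((g⁻¹).val)ᴴ * (g.val)ᴴ = 1 := by
    rw [← conjTranspose_mul, hg, conjTranspose_one]
  simp only [mulVecLin_apply, scaleKraus, mulVec_mulVec]
  rw [star_mulVec, ← dotProduct_mulVec, mulVec_mulVec, Matrix.mul_assoc, hk, Matrix.mul_one,
    ← Matrix.mul_assoc, hg', Matrix.one_mul]
  exact h i y hy x hx

/-- A triangular matrix maps each member of the flag into itself; this is where triangularity of the
scalings enters. -/
theorem finrank_inf_le_map {k : ℕ} {g : GL (Fin k) ℂ} (hg : g ∈ upperGL k)
    (L : Submodule ℂ (Fin k → ℂ)) (i : Fin k) :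
    Module.finrank ℂ ↥(stdFlag i ⊓ L) ≤
      Module.finrank ℂ ↥(stdFlag i ⊓ L.map g.val.mulVecLin) := by
  have hinj : Function.Injective g.val.mulVecLin := mulVec_injective_of_isUnit g.isUnit
  rw [(Submodule.equivMapOfInjective _ hinj (stdFlag i ⊓ L)).finrank_eq]
  refine Submodule.finrank_mono (le_inf ?_ (Submodule.map_mono inf_le_right))
  rintro _ ⟨x, hx, rfl⟩
  rw [mem_stdFlag]
  intro l hl
  rw [mulVecLin_apply, mulVec, dotProduct]
  refine Finset.sum_eq_zero fun c _ => ?_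
  rcases le_or_gt c i with hc | hc
  · have : g.val l c = 0 := hg (lt_of_le_of_lt hc hl)
    rw [this, zero_mul]
  · rw [mem_stdFlag.1 hx.1 c hc, mul_zero]

/-- The two marginals `T(1)` and `T*(1)` have equal traces, and they approximate `Q` and `P`. -/
theorem sum_eq_of_triangularScalable (h : TriangularScalable A p q) :
    ∑ j, p j = ∑ i, q i := by
  have key : ∀ ε : ℝ, 0 < ε → |∑ j, p j - ∑ i, q i| ≤ (m * m + n * n) * ε := by
    intro ε hε
    obtain ⟨g, hg, k, hk, h1, h2⟩ := h ε hε
    have h3 := (isProjOnto_top m).mul_trace_le h1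
    have h4 := (isProjOnto_top n).mul_trace_le h2
    have e1 := re_trace_diagC_mul q 1
    have e2 := re_trace_diagC_mul p 1
    simp only [one_apply_eq, Complex.one_re, mul_one] at e1 e2
    rw [Matrix.mul_one] at h3 h4
    rw [trace_sub, Complex.sub_re] at h3 h4
    rw [e1, trace_krausMap_one] at h3
    rw [e2] at h4
    rw [abs_le] at h3 h4 ⊢
    constructor <;> linarith [h3.1, h3.2, h4.1, h4.2]
  by_contra hne
  have hpos : 0 < |∑ j, p j - ∑ i, q i| := abs_pos.2 (sub_ne_zero.2 hne)
  have hC : (0 : ℝ) < m * m + n * n + 1 := by positivity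
  have := key (|∑ j, p j - ∑ i, q i| / (m * m + n * n + 1)) (by positivity)
  rw [mul_div_assoc', le_div_iff₀ hC] at this
  nlinarith

theorem rankNondecreasing_of_triangularScalable (hp : IsSpectrum p) (hq : IsSpectrum q)
    (h : TriangularScalable A p q) : RankNondecreasing A p q := by
  intro L R hLR
  refine le_of_forall_pos_le_add fun δ hδ => ?_
  -- The error is `m * m * ε` from testing the first marginal on `π`, and `n * n * ε` each from
  -- testing the second on `ρ` and on `1`.
  have hC : (0 : ℝ) < m * m + 2 * (n * n) + 1 := by positivity
  obtain ⟨g, hg, k, hk, h1, h2⟩ := h (δ / (m * m + 2 * (n * n) + 1)) (by positivity)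
  set ε := δ / (m * m + 2 * (n * n) + 1)
  have hε : (m * m + 2 * (n * n) + 1) * ε = δ := by
    simp only [ε]
    field_simp
  have hε0 : 0 < ε := by positivity
  obtain ⟨π, hπ⟩ := exists_isProjOnto (L.map (g⁻¹).val.mulVecLin)
  obtain ⟨ρ, hρ⟩ := exists_isProjOnto (R.map (k⁻¹).val.mulVecLin)
  have hle := (hLR.scale g k).trace_add_le hπ hρ
  have hL : ∑ i, delta q i * (Module.finrank ℂ ↥(stdFlag i ⊓ L) : ℝ) ≤
      (diagC q * π).trace.re := by
    refine le_trans (Finset.sum_le_sum fun i _ => ?_) (hπ.sum_delta_finrank_le hq)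
    refine mul_le_mul_of_nonneg_left ?_ (hq.delta_nonneg i)
    exact_mod_cast finrank_inf_le_map (inv_mem_upperGL hg) L i
  have hR : ∑ j, delta p j * (Module.finrank ℂ ↥(stdFlag j ⊓ R) : ℝ) ≤
      (diagC p * ρ).trace.re := by
    refine le_trans (Finset.sum_le_sum fun i _ => ?_) (hρ.sum_delta_finrank_le hp)
    refine mul_le_mul_of_nonneg_left ?_ (hp.delta_nonneg i)
    exact_mod_cast finrank_inf_le_map (inv_mem_upperGL hk) R i
  have h3 := (abs_le.1 (hπ.mul_trace_le h1)).2
  have h4 := (abs_le.1 (hρ.mul_trace_le h2)).2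
  have h5 := (abs_le.1 ((isProjOnto_top n).mul_trace_le h2)).1
  rw [Matrix.sub_mul, trace_sub, Complex.sub_re] at h3 h4
  rw [Matrix.mul_one, trace_sub, Complex.sub_re] at h5
  have e2 := re_trace_diagC_mul p 1
  simp only [one_apply_eq, Complex.one_re, mul_one] at e2
  rw [e2] at h5
  nlinarith

end

/-! ### Greedy minors and the Cauchy–Binet lower bound. -/

/-- A linearly independent subfamily that spans every level of a filtration of the index set. -/
theorem exists_linearIndepOn_filtered {ι V : Type*} [AddCommGroup V] [Module ℂ V] (v : ι → V)
    (κ : ι → ℕ) (N : ℕ) :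
    ∃ b : Set ι, b ⊆ {i | κ i < N} ∧ LinearIndepOn ℂ v b ∧
      ∀ K ≤ N, v '' {i | κ i < K} ⊆ Submodule.span ℂ (v '' (b ∩ {i | κ i < K})) := by
  induction N with
  | zero =>
    refine ⟨∅, Set.empty_subset _, linearIndepOn_empty _ _, fun K hK => ?_⟩
    obtain rfl := Nat.le_zero.1 hK
    simp
  | succ N ih =>
    obtain ⟨b, hb, hli, hspan⟩ := ih
    obtain ⟨b', hb', hbb', hspan', hli'⟩ := exists_linearIndepOn_extension hli
      (t := {i | κ i < N + 1}) (hb.trans fun i (hi : κ i < N) => Nat.lt_succ_of_lt hi)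
    refine ⟨b', hb', hli', fun K hK => ?_⟩
    rcases Nat.lt_or_eq_of_le hK with h | rfl
    · exact (hspan K (Nat.lt_succ_iff.1 h)).trans (Submodule.span_mono
        (Set.image_mono (Set.inter_subset_inter_left _ hbb')))
    · rwa [Set.inter_eq_left.2 hb']

/-- The vectors orthogonal to the columns of `M` with index in `s`. -/
def colNull {d ι : Type*} [Fintype d] (M : Matrix d ι ℂ) (s : Set ι) : Submodule ℂ (d → ℂ) where
  carrier := {y | ∀ i ∈ s, star (M.col i) ⬝ᵥ y = 0}
  add_mem' := fun hx hy i hi => by rw [dotProduct_add, hx i hi, hy i hi, add_zero]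
  zero_mem' := fun i _ => dotProduct_zero _
  smul_mem' := fun c x hx i hi => by rw [dotProduct_smul, hx i hi, smul_zero]

theorem mem_colNull {d ι : Type*} [Fintype d] {M : Matrix d ι ℂ} {s : Set ι} {y : d → ℂ} :
    y ∈ colNull M s ↔ ∀ i ∈ s, star (M.col i) ⬝ᵥ y = 0 := Iff.rfl

/-- Rank–nullity for the conjugate transpose of the submatrix of columns in `s`. -/
theorem finrank_span_add_finrank_colNull {d ι : Type*} [Fintype d] [DecidableEq d] [Fintype ι]
    (M : Matrix d ι ℂ) (s : Set ι) :
    Module.finrank ℂ (Submodule.span ℂ (M.col '' s)) + Module.finrank ℂ (colNull M s) =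
      Fintype.card d := by
  classical
  set Ms : Matrix d s ℂ := M.submatrix id (fun i : s => (i : ι)) with hMs
  have h1 : colNull M s = LinearMap.ker Msᴴ.mulVecLin := by
    ext y
    rw [LinearMap.mem_ker, mulVecLin_apply, funext_iff]
    exact ⟨fun h i => h i.1 i.2, fun h i hi => h ⟨i, hi⟩⟩
  have h2 : Module.finrank ℂ (Submodule.span ℂ (M.col '' s)) = Msᴴ.rank := by
    rw [rank_conjTranspose, rank_eq_finrank_span_cols]
    have : Set.range Ms.col = M.col '' s := by
      ext y
      constructor
      · rintro ⟨i, rfl⟩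
        exact ⟨i.1, i.2, rfl⟩
      · rintro ⟨i, hi, rfl⟩
        exact ⟨⟨i, hi⟩, rfl⟩
    rw [this]
  rw [h1, h2, Matrix.rank, LinearMap.finrank_range_add_finrank_ker, Module.finrank_fintype_fun_eq_card]

/-- A nonzero maximal minor that is greedy for the filtration of the columns by `κ`. -/
theorem exists_greedy_minor {d N : ℕ} {ι : Type*} [Fintype ι] (M : Matrix (Fin d) ι ℂ)
    (κ : ι → ℕ) (hκ : ∀ i, κ i < N) (hfull : colNull M Set.univ = ⊥) :
    ∃ e : Fin d → ι, Function.Injective e ∧ (M.submatrix id e).det ≠ 0 ∧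
      ∀ K, (d : ℝ) - Module.finrank ℂ (colNull M {i | κ i < K}) ≤
        ∑ s, if κ (e s) < K then 1 else 0 := by
  classical
  obtain ⟨b, -, hli, hspan⟩ := exists_linearIndepOn_filtered M.col κ N
  have huniv : ∀ K, N ≤ K → {i | κ i < K} = Set.univ := fun K hK =>
    Set.eq_univ_of_forall fun i => (hκ i).trans_le hK
  have htop : Submodule.span ℂ (M.col '' b) = ⊤ := by
    have h1 := hspan N le_rfl
    rw [huniv N le_rfl, Set.inter_univ] at h1
    have h2 := finrank_span_add_finrank_colNull M Set.univ
    rw [hfull, finrank_bot, add_zero] at h2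
    rw [eq_top_iff, ← Submodule.eq_top_of_finrank_eq (h2.trans
      (Module.finrank_fintype_fun_eq_card ℂ).symm)]
    exact Submodule.span_le.2 h1
  let B : Module.Basis b ℂ (Fin d → ℂ) := Module.Basis.mk hli (by
    rw [← htop, Set.image_eq_range])
  have hcard : Fintype.card b = d := by
    rw [← Module.finrank_eq_card_basis B, Module.finrank_fintype_fun_eq_card, Fintype.card_fin]
  let e' : Fin d ≃ b := (Fintype.equivFinOfCardEq hcard).symm
  refine ⟨fun s => e' s, Subtype.val_injective.comp e'.injective, ?_, fun K => ?_⟩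
  · have h : LinearIndependent ℂ (M.submatrix id fun s => (e' s : ι)).col :=
      LinearIndependent.comp hli e' e'.injective
    exact ((Matrix.isUnit_iff_isUnit_det _).1
      (Matrix.linearIndependent_cols_iff_isUnit.1 h)).ne_zero
  · have h1 := finrank_span_add_finrank_colNull M {i | κ i < K}
    rw [Fintype.card_fin] at h1
    -- The selected columns of level below `K` span all columns of level below `K`, so there are at
    -- least as many of them as the rank.
    have h2 : Submodule.span ℂ (M.col '' {i | κ i < K}) ≤
        Submodule.span ℂ (((Finset.univ.filter fun s => κ (e' s) < K).image
          fun s => M.col (e' s) : Finset (Fin d → ℂ)) : Set (Fin d → ℂ)) := by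
      have hmin : {i | κ i < K} = {i | κ i < min K N} := by
        ext i
        simp [hκ i]
      have hK := hspan (min K N) (min_le_right _ _)
      rw [← hmin] at hK
      refine Submodule.span_le.2 (hK.trans (Submodule.span_mono ?_))
      rintro _ ⟨i, ⟨hib, hi⟩, rfl⟩
      simp only [Finset.coe_image, Finset.coe_filter, Finset.mem_univ, true_and]
      refine ⟨e'.symm ⟨i, hib⟩, ?_, ?_⟩
      · simpa using hi
      · simp
    have h3 := (Submodule.finrank_mono h2).trans ((finrank_span_finset_le_card _).trans
      Finset.card_image_le)
    have h4 : (∑ s, if κ (e' s) < K then (1 : ℝ) else 0) =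
        ((Finset.univ.filter fun s => κ (e' s) < K).card : ℝ) := by
      simp
    rw [h4, sub_le_iff_le_add]
    have : d ≤ (Finset.univ.filter fun s => κ (e' s) < K).card +
        Module.finrank ℂ (colNull M {i | κ i < K}) := by omega
    exact_mod_cast this

/-- Extension by zero embeds the null space of the leading rows into the flag member. -/
theorem finrank_colNull_leadingRows_le {k : ℕ} {ι : Type*} (M : Matrix (Fin k) ι ℂ) (s : Set ι)
    (j : Fin k) : Module.finrank ℂ (colNull (M.submatrix (Fin.castLE j.isLt) id) s) ≤
      Module.finrank ℂ ↥(stdFlag j ⊓ colNull M s) := by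
  let f := Function.ExtendByZero.linearMap ℂ (Fin.castLE (Nat.succ_le_of_lt j.isLt))
  have hc : Function.Injective (Fin.castLE (Nat.succ_le_of_lt j.isLt)) := Fin.castLE_injective _
  have hf : ∀ (y : Fin ((j : ℕ) + 1) → ℂ) i,
      f y (Fin.castLE (Nat.succ_le_of_lt j.isLt) i) = y i :=
    fun y i => hc.extend_apply y 0 i
  have hf0 : ∀ (y : Fin ((j : ℕ) + 1) → ℂ) l, j < l → f y l = 0 := by
    intro y l hl
    refine Function.extend_apply' _ _ _ ?_
    rintro ⟨i, rfl⟩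
    exact absurd (Nat.le_of_lt_succ i.isLt) (not_le.2 hl)
  have hinj : Function.Injective f := fun x y hxy => by
    funext i
    rw [← hf x, ← hf y, hxy]
  rw [(Submodule.equivMapOfInjective f hinj _).finrank_eq]
  refine Submodule.finrank_mono ?_
  rintro _ ⟨y, hy, rfl⟩
  refine ⟨mem_stdFlag.2 (hf0 y), fun i hi => ?_⟩
  rw [← hy i hi, dotProduct, dotProduct, ← sum_castLE_of_zero j]
  · refine Finset.sum_congr rfl fun c _ => ?_
    rw [hf]
    rfl
  · intro l hl
    rw [hf0 y l hl, mul_zero]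

theorem mul_diagonal_mul_conjTranspose_apply {d ι : Type*} [Fintype ι] [DecidableEq ι]
    (M : Matrix d ι ℂ) (w : ι → ℂ) (a b : d) :
    (M * diagonal w * Mᴴ) a b = ∑ i, M a i * w i * star (M b i) := by
  simp [mul_apply (M := _ * diagonal _), mul_diagonal]

/-- This keeps one term of the Cauchy–Binet expansion. The columns outside the range of `e`
contribute a positive semidefinite summand, which can only increase the determinant. -/
theorem normSq_det_mul_prod_le {d : ℕ} {ι : Type*} [Fintype ι] [DecidableEq ι]
    (M : Matrix (Fin d) ι ℂ) (w : ι → ℝ) (hw : ∀ i, 0 < w i) {e : Fin d → ι}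
    (he : Function.Injective e) :
    Complex.normSq (M.submatrix id e).det * ∏ s, w (e s) ≤
      (M * (diagonal fun i => (w i : ℂ)) * Mᴴ).det.re := by
  classical
  set P := M.submatrix id e with hP
  set D : Matrix (Fin d) (Fin d) ℂ := diagonal fun s => (w (e s) : ℂ)
  have hDp : D.PosDef := PosDef.diagonal fun s => by simpa using hw (e s)
  have hfull : (M * (diagonal fun i => (w i : ℂ)) * Mᴴ).PosSemidef :=
    (PosSemidef.diagonal fun i => by simpa using (hw i).le).mul_mul_conjTranspose_same M
  have hdet : (P * D * Pᴴ).det = ((Complex.normSq P.det * ∏ s, w (e s) : ℝ) : ℂ) := by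
    rw [det_mul, det_mul, det_conjTranspose, det_diagonal, mul_right_comm, Complex.star_def,
      Complex.mul_conj]
    push_cast
    rfl
  rcases eq_or_ne P.det 0 with h0 | h0
  · rw [h0, map_zero, zero_mul]
    exact (Complex.le_def.1 hfull.det_nonneg).1
  have hA : (P * D * Pᴴ).PosDef := by
    rw [((hDp.posSemidef).mul_mul_conjTranspose_same P).posDef_iff_det_ne_zero, hdet]
    exact_mod_cast (mul_pos (Complex.normSq_pos.2 h0) (Finset.prod_pos fun s _ => hw _)).ne'
  set B : Matrix ι ι ℂ := diagonal fun i => if i ∈ Set.range e then 0 else (w i : ℂ)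
  have hB : (M * B * Mᴴ).PosSemidef := by
    refine PosSemidef.mul_mul_conjTranspose_same (PosSemidef.diagonal fun i => ?_) M
    by_cases hi : i ∈ Set.range e
    · simp [hi]
    · simpa [hi] using (hw i).le
  have hsum : M * (diagonal fun i => (w i : ℂ)) * Mᴴ = P * D * Pᴴ + M * B * Mᴴ := by
    ext a b
    rw [Matrix.add_apply, mul_diagonal_mul_conjTranspose_apply,
      mul_diagonal_mul_conjTranspose_apply, mul_diagonal_mul_conjTranspose_apply]
    simp only [hP, submatrix_apply, id]
    rw [← Finset.sum_image (s := Finset.univ) (g := e)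
      (f := fun i => M a i * (w i : ℂ) * star (M b i)) he.injOn,
      ← Finset.sum_filter_add_sum_filter_not Finset.univ (fun i => i ∈ Set.range e)]
    congr 1
    · refine Finset.sum_congr ?_ fun _ _ => rfl
      ext i
      simp
    · rw [Finset.sum_filter]
      refine Finset.sum_congr rfl fun i _ => ?_
      by_cases hi : i ∈ Set.range e <;> simp [hi]
  have := (Complex.le_def.1 (det_le_det_add hA hB)).1
  rwa [← hsum, hdet, Complex.ofReal_re] at this

/-- Summation by parts: the differences of `x` are nonnegative except possibly the last, `x (n - 1)
- 0`, whose partner is the total sum of `w`, namely zero. -/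
theorem sum_mul_nonneg_of_antitone {n : ℕ} {x w : Fin n → ℝ} (hx : Antitone x)
    (hw : ∀ K, K ≤ n → 0 ≤ ∑ c : Fin n, if (c : ℕ) < K then w c else 0) (h0 : ∑ c, w c = 0) :
    0 ≤ ∑ c, x c * w c := by
  rw [← sum_delta_mul]
  refine Finset.sum_nonneg fun j _ => ?_
  have e : ∑ i : Fin ((j : ℕ) + 1), w (Fin.castLE j.isLt i) =
      ∑ c : Fin n, if (c : ℕ) < (j : ℕ) + 1 then w c else 0 := by
    rw [← sum_castLE_of_zero j]
    · refine Finset.sum_congr rfl fun i _ => ?_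
      rw [if_pos (by simpa using Nat.le_of_lt_succ i.isLt)]
    · intro i hi
      rw [if_neg]
      have : (j : ℕ) < i := hi
      omega
  rw [e]
  by_cases hj : (j : ℕ) + 1 < n
  · refine mul_nonneg ?_ (hw _ hj.le)
    rw [delta, dif_pos hj]
    exact sub_nonneg.2 (hx (Fin.le_def.2 (Nat.le_succ _)))
  · have : (∑ c : Fin n, if (c : ℕ) < (j : ℕ) + 1 then w c else 0) = 0 := by
      rw [← h0]
      refine Finset.sum_congr rfl fun c _ => if_pos ?_
      omega
    rw [this, mul_zero]

/-! ### Locally uniform monomial bounds for relative determinants. -/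

section

variable {k n : ℕ} {ι E : Type*} [Fintype ι] [DecidableEq ι] [TopologicalSpace E]

/-- A greedy minor that is nonzero at `u` keeps at least half its squared modulus nearby. The
exponent `ν l` is `Δ a j` times the number of selected columns of weight index `l`, so greediness
bounds its partial sums below. -/
theorem exists_minor_lower_bound {M : E → Matrix (Fin k) ι ℂ} (hM : Continuous M) (u : E)
    {a : Fin k → ℝ} (ha : IsSpectrum a) (κ : ι → Fin n) (j : Fin k)
    (hfull : delta a j ≠ 0 → stdFlag j ⊓ colNull (M u) Set.univ = ⊥) :
    ∃ c > 0, ∃ ν : Fin n → ℝ, ∑ l, ν l = delta a j * (((j : ℕ) : ℝ) + 1) ∧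
      (∀ K : ℕ, delta a j * (((j : ℕ) : ℝ) + 1) - delta a j *
        (Module.finrank ℂ ↥(stdFlag j ⊓ colNull (M u) {i | (κ i : ℕ) < K}) : ℝ) ≤
          ∑ l : Fin n, if (l : ℕ) < K then ν l else 0) ∧
      ∀ᶠ u' in nhds u, ∀ x : Fin n → ℝ, c * Real.exp (∑ l, ν l * x l) ≤
        (leadingBlock (M u' * (diagonal fun i => (Real.exp (x (κ i)) : ℂ)) * (M u')ᴴ) j).det.re ^
          delta a j := by
  rcases (ha.delta_nonneg j).eq_or_lt' with h0 | h0
  · exact ⟨1, one_pos, 0, by simp [h0], by simp [h0], by simp [h0]⟩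
  set M' : E → Matrix (Fin ((j : ℕ) + 1)) ι ℂ := fun u' =>
    (M u').submatrix (Fin.castLE j.isLt) id
  have hfull' : colNull (M' u) Set.univ = ⊥ := by
    rw [← Submodule.finrank_eq_zero]
    have := finrank_colNull_leadingRows_le (M u) Set.univ j
    rw [hfull h0.ne', finrank_bot] at this
    exact Nat.le_zero.1 this
  obtain ⟨e, he, hdet, hK⟩ := exists_greedy_minor (M' u) (fun i => (κ i : ℕ)) (N := n)
    (fun i => (κ i).isLt) hfull'
  have hpos := Complex.normSq_pos.2 hdet
  have hsum : ∀ y : Fin n → ℝ, ∑ l, (∑ s, if κ (e s) = l then (1 : ℝ) else 0) * y l =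
      ∑ s, y (κ (e s)) := by
    intro y
    simp only [Finset.sum_mul]
    rw [Finset.sum_comm]
    simp
  set ν : Fin n → ℝ := fun l => delta a j * ∑ s, if κ (e s) = l then (1 : ℝ) else 0
  have hν : ∀ y : Fin n → ℝ, ∑ l, ν l * y l = delta a j * ∑ s, y (κ (e s)) := by
    intro y
    rw [← hsum, Finset.mul_sum]
    simp only [ν, mul_assoc]
  refine ⟨(Complex.normSq ((M' u).submatrix id e).det / 2) ^ delta a j,
    Real.rpow_pos_of_pos (half_pos hpos) _, ν, ?_, fun K => ?_, ?_⟩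
  · simpa using hν 1
  · have h1 := hν fun l => if (l : ℕ) < K then 1 else 0
    simp only [mul_ite, mul_one, mul_zero] at h1
    have h1' : (∑ l : Fin n, if (l : ℕ) < K then ν l else 0) =
        delta a j * ∑ s, if (κ (e s) : ℕ) < K then 1 else 0 := h1
    rw [h1', ← mul_sub]
    refine mul_le_mul_of_nonneg_left ?_ h0.le
    have h2 := hK K
    have h3 : (Module.finrank ℂ (colNull (M' u) {i | (κ i : ℕ) < K}) : ℝ) ≤
        Module.finrank ℂ ↥(stdFlag j ⊓ colNull (M u) {i | (κ i : ℕ) < K}) := by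
      exact_mod_cast finrank_colNull_leadingRows_le (M u) _ j
    push_cast at h2
    linarith
  · have hcont : Continuous fun u' => Complex.normSq ((M' u').submatrix id e).det :=
      Complex.continuous_normSq.comp ((hM.matrix_submatrix _ _).matrix_submatrix _ _).matrix_det
    filter_upwards [continuousAt_const.eventually_lt hcont.continuousAt (half_lt_self hpos)]
      with u' hu' x
    have h1 := normSq_det_mul_prod_le (M' u') (fun i => Real.exp (x (κ i)))
      (fun i => Real.exp_pos _) he
    rw [← Real.exp_sum] at h1
    have h2 : leadingBlock (M u' * (diagonal fun i => (Real.exp (x (κ i)) : ℂ)) * (M u')ᴴ) j =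
        M' u' * (diagonal fun i => (Real.exp (x (κ i)) : ℂ)) * (M' u')ᴴ := by
      ext s t
      simp [leadingBlock, M', mul_apply (M := _ * diagonal _), mul_diagonal]
    rw [h2, hν, mul_comm (delta a j), Real.exp_mul, ← Real.mul_rpow (half_pos hpos).le
      (Real.exp_pos _).le]
    refine Real.rpow_le_rpow (by positivity) (le_trans ?_ h1) h0.le
    gcongr

theorem exists_relDet_lower_bound {M : E → Matrix (Fin k) ι ℂ} (hM : Continuous M) (u : E)
    {a : Fin k → ℝ} (ha : IsSpectrum a) (κ : ι → Fin n)
    (hfull : ∀ j, delta a j ≠ 0 → stdFlag j ⊓ colNull (M u) Set.univ = ⊥) :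
    ∃ c > 0, ∃ ν : Fin n → ℝ, ∑ l, ν l = ∑ i, a i ∧
      (∀ K : ℕ, ∑ i, a i - ∑ j, delta a j *
        (Module.finrank ℂ ↥(stdFlag j ⊓ colNull (M u) {i | (κ i : ℕ) < K}) : ℝ) ≤
          ∑ l : Fin n, if (l : ℕ) < K then ν l else 0) ∧
      ∀ᶠ u' in nhds u, ∀ x : Fin n → ℝ, c * Real.exp (∑ l, ν l * x l) ≤
        relDet a (M u' * (diagonal fun i => (Real.exp (x (κ i)) : ℂ)) * (M u')ᴴ) := by
  choose c hc ν h1 h2 h3 using fun j => exists_minor_lower_bound hM u ha κ j (hfull j)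
  refine ⟨∏ j, c j, Finset.prod_pos fun j _ => hc j, fun l => ∑ j, ν j l, ?_, fun K => ?_, ?_⟩
  · rw [Finset.sum_comm, ← sum_delta_mul_card a]
    exact Finset.sum_congr rfl fun j _ => h1 j
  · have : (∑ l : Fin n, if (l : ℕ) < K then ∑ j, ν j l else 0) =
        ∑ j, ∑ l : Fin n, if (l : ℕ) < K then ν j l else 0 := by
      rw [Finset.sum_comm]
      refine Finset.sum_congr rfl fun l _ => ?_
      split_ifs <;> simp
    rw [this, ← sum_delta_mul_card a, ← Finset.sum_sub_distrib]
    exact Finset.sum_le_sum fun j _ => h2 j K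
  · filter_upwards [Filter.eventually_all.2 h3] with u' hu' x
    have : ∑ l, (∑ j, ν j l) * x l = ∑ j, ∑ l, ν j l * x l := by
      simp only [Finset.sum_mul]
      rw [Finset.sum_comm]
    rw [this, Real.exp_sum, ← Finset.prod_mul_distrib, relDet]
    exact Finset.prod_le_prod (fun j _ => mul_nonneg (hc j).le (Real.exp_pos _).le)
      fun j _ => hu' j x

end

/-! ### From the rank condition to positive capacity. -/

section

variable {m n r : ℕ} {A : Fin r → Matrix (Fin m) (Fin n) ℂ} {p : Fin n → ℝ} {q : Fin m → ℝ}

/-- The columns of all the matrices `A i * U`, side by side. -/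
def krausCols (A : Fin r → Matrix (Fin m) (Fin n) ℂ) (U : Matrix (Fin n) (Fin n) ℂ) :
    Matrix (Fin m) (Fin r × Fin n) ℂ :=
  of fun a i => (A i.1 * U) a i.2

/-- This brings `T(U w U†)` to the form `M D M†` to which the minor bounds apply. -/
theorem krausMap_conj_diagonal (U : Matrix (Fin n) (Fin n) ℂ) (w : Fin n → ℂ) :
    krausMap A (U * diagonal w * Uᴴ) =
      krausCols A U * (diagonal fun i : Fin r × Fin n => w i.2) * (krausCols A U)ᴴ := by
  ext a b
  rw [mul_diagonal_mul_conjTranspose_apply, Fintype.sum_prod_type, krausMap, Matrix.sum_apply]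
  refine Finset.sum_congr rfl fun i _ => ?_
  have : A i * (U * diagonal w * Uᴴ) * (A i)ᴴ = A i * U * diagonal w * (A i * U)ᴴ := by
    rw [conjTranspose_mul]
    simp only [Matrix.mul_assoc]
  rw [this, mul_diagonal_mul_conjTranspose_apply]
  rfl

theorem continuous_krausCols : Continuous (krausCols A) := by
  unfold krausCols
  refine continuous_matrix fun a i => ?_
  exact (continuous_const.matrix_mul continuous_id).matrix_elem a i.2

theorem col_krausCols (U : Matrix (Fin n) (Fin n) ℂ) (i : Fin r × Fin n) :
    (krausCols A U).col i = A i.1 *ᵥ U.col i.2 := by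
  funext a
  rfl

/-- A vector orthogonal to the columns in `t` expands in columns of `U` from `s`, and their images
under the Kraus operators are orthogonal to the first space. -/
theorem independent_colNull {U : Matrix (Fin n) (Fin n) ℂ} (hU : U * Uᴴ = 1)
    {s t : Set (Fin n)} (hst : ∀ c, c ∈ s ∨ c ∈ t) :
    Independent A (colNull (krausCols A U) {i | i.2 ∈ s}) (colNull U t) := by
  intro l y hy x hx
  have hx' : x = ∑ c, (star (U.col c) ⬝ᵥ x) • U.col c := by
    have h1 : U *ᵥ (Uᴴ *ᵥ x) = x := by rw [mulVec_mulVec, hU, one_mulVec]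
    conv_lhs => rw [← h1]
    funext a
    rw [mulVec, dotProduct, Finset.sum_apply]
    exact Finset.sum_congr rfl fun c _ => mul_comm _ _
  rw [hx', mulVec_sum, dotProduct_sum]
  refine Finset.sum_eq_zero fun c _ => ?_
  rw [mulVec_smul, dotProduct_smul]
  rcases hst c with hc | hc
  · have := hy (l, c) hc
    rw [col_krausCols] at this
    have h2 : star y ⬝ᵥ A l *ᵥ U.col c = star (star (A l *ᵥ U.col c) ⬝ᵥ y) := by
      rw [← star_dotProduct_star, star_star]
    rw [h2, this, star_zero, smul_zero]
  · rw [hx c hc, zero_smul]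

theorem finrank_stdFlag_top {k : ℕ} (j : Fin k) :
    Module.finrank ℂ ↥(stdFlag j ⊓ (⊤ : Submodule ℂ (Fin k → ℂ))) = (j : ℕ) + 1 := by
  rw [inf_top_eq, stdFlag, Set.image_eq_range, finrank_span_eq_card]
  · simp
  · have := (Pi.basisFun ℂ (Fin k)).linearIndependent.comp (fun x : Set.Iic j => (x : Fin k))
      Subtype.val_injective
    simpa [Function.comp_def] using this

/-- With the whole space as `R` the `p`-terms already exhaust `∑ p`, so every nonnegative `q`-term
must vanish. -/
theorem stdFlag_inf_colNull_krausCols_eq_bot (hq : IsSpectrum q)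
    (h : RankNondecreasing A p q) {U : Matrix (Fin n) (Fin n) ℂ} (hU : U * Uᴴ = 1) (j : Fin m)
    (hj : delta q j ≠ 0) : stdFlag j ⊓ colNull (krausCols A U) Set.univ = ⊥ := by
  have htop : colNull U (∅ : Set (Fin n)) = ⊤ := by
    ext
    simp [mem_colNull]
  have h1 := h _ _ (independent_colNull (A := A) hU (s := Set.univ) (t := ∅) (by simp))
  rw [htop] at h1
  simp only [finrank_stdFlag_top, Nat.cast_add, Nat.cast_one, sum_delta_mul_card] at h1
  have h2 : ∀ i, 0 ≤ delta q i *
      (Module.finrank ℂ ↥(stdFlag i ⊓ colNull (krausCols A U) Set.univ) : ℝ) :=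
    fun i => mul_nonneg (hq.delta_nonneg i) (Nat.cast_nonneg _)
  have h3 := (Finset.single_le_sum (fun i _ => h2 i) (Finset.mem_univ j)).trans
    (le_sub_iff_add_le.2 h1)
  rw [sub_self] at h3
  have h4 := (mul_eq_zero.1 (le_antisymm h3 (h2 j))).resolve_left hj
  rw [← Submodule.finrank_eq_zero]
  exact_mod_cast h4

theorem colNull_univ_eq_bot {U : Matrix (Fin n) (Fin n) ℂ} (hU : U * Uᴴ = 1) :
    colNull U Set.univ = ⊥ := by
  rw [eq_bot_iff]
  intro y hy
  have h1 : Uᴴ *ᵥ y = 0 := by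
    funext c
    exact hy c (Set.mem_univ c)
  have h2 : U *ᵥ (Uᴴ *ᵥ y) = y := by rw [mulVec_mulVec, hU, one_mulVec]
  rw [Submodule.mem_bot, ← h2, h1, mulVec_zero]

/-- The product dominates a constant times `exp (∑ x l * (ν₁ l - ν₂ l.rev))`. The rank condition
makes the partial sums of these coefficients nonnegative, equality of traces makes their total zero,
and `x` is antitone. -/
theorem exists_local_lower_bound (hp : IsSpectrum p) (hq : IsSpectrum q)
    (hsum : ∑ j, p j = ∑ i, q i) (h : RankNondecreasing A p q)
    {U : Matrix (Fin n) (Fin n) ℂ} (hU : U * Uᴴ = 1) :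
    ∃ c > 0, ∀ᶠ V in nhds U, ∀ x : Fin n → ℝ, Antitone x →
      c ≤ relDet q (krausMap A (V * (diagonal fun i => (Real.exp (x i) : ℂ)) * Vᴴ)) *
        relDet p (V * (diagonal fun i => (Real.exp (-x i) : ℂ)) * Vᴴ) := by
  obtain ⟨c₁, hc₁, ν₁, hs₁, hK₁, hb₁⟩ := exists_relDet_lower_bound
    (continuous_krausCols (A := A)) U hq (fun i : Fin r × Fin n => i.2)
    (stdFlag_inf_colNull_krausCols_eq_bot hq h hU)
  -- The weights `exp (-x i)` increase with `i`, so the greedy choice must run through the columns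
  -- in reverse order.
  obtain ⟨c₂, hc₂, ν₂, hs₂, hK₂, hb₂⟩ := exists_relDet_lower_bound
    (continuous_id (X := Matrix (Fin n) (Fin n) ℂ)) U hp Fin.rev
    (fun j _ => by rw [id, colNull_univ_eq_bot hU, inf_bot_eq])
  refine ⟨c₁ * c₂, mul_pos hc₁ hc₂, ?_⟩
  filter_upwards [hb₁, hb₂] with V h₁ h₂ x hx
  have h₁x := h₁ x
  have h₂x := h₂ fun l => -x l.rev
  simp only [id, Fin.rev_rev] at h₂x
  rw [← krausMap_conj_diagonal (A := A) V fun i => (Real.exp (x i) : ℂ)] at h₁x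
  have hrev : ∀ f : Fin n → ℝ, ∑ l : Fin n, f l.rev = ∑ l, f l := fun f =>
    Equiv.sum_comp Fin.revPerm f
  have hnn : 0 ≤ ∑ l, x l * (ν₁ l - ν₂ l.rev) := by
    refine sum_mul_nonneg_of_antitone hx (fun K hK => ?_) ?_
    · have e : (∑ l : Fin n, if (l : ℕ) < K then ν₁ l - ν₂ l.rev else 0) =
          (∑ l : Fin n, if (l : ℕ) < K then ν₁ l else 0) -
            (∑ i, p i - ∑ l : Fin n, if (l : ℕ) < n - K then ν₂ l else 0) := by
        rw [← hs₂, ← hrev ν₂, ← hrev fun l => if (l : ℕ) < n - K then ν₂ l else 0,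
          ← Finset.sum_sub_distrib, ← Finset.sum_sub_distrib]
        refine Finset.sum_congr rfl fun l _ => ?_
        by_cases hl : (l : ℕ) < K
        · have : ¬ ((l.rev : Fin n) : ℕ) < n - K := by
            rw [Fin.val_rev]
            omega
          rw [if_pos hl, if_pos hl, if_neg this, sub_zero]
        · have : ((l.rev : Fin n) : ℕ) < n - K := by
            rw [Fin.val_rev]
            omega
          rw [if_neg hl, if_neg hl, if_pos this, sub_self, sub_self]
      -- Here `R` is the span of the first `K` columns of `U`, described as the complement of the
      -- last `n - K`, and `L` is orthogonal to the images of those `K` columns.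
      have hR := h _ _ (independent_colNull (A := A) hU (s := {c | (c : ℕ) < K})
        (t := {c | ((c.rev : Fin n) : ℕ) < n - K}) fun c => by
          simp only [Set.mem_ofPred_eq, Fin.val_rev]
          omega)
      have hK₁' := hK₁ K
      have hK₂' := hK₂ (n - K)
      rw [e]
      refine (sub_nonneg.2 hR).trans ?_
      simp only [Set.mem_ofPred_eq, id] at hK₁' hK₂' ⊢
      linarith
    · rw [Finset.sum_sub_distrib, hrev ν₂, hs₁, hs₂, hsum, sub_self]
  have hexp : 1 ≤ Real.exp (∑ l, ν₁ l * x l) * Real.exp (∑ l, ν₂ l * -x l.rev) := by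
    rw [← Real.exp_add, Real.one_le_exp_iff]
    have : ∑ l, ν₂ l * -x l.rev = ∑ l, ν₂ l.rev * -x l := by
      rw [← hrev fun l => ν₂ l.rev * -x l]
      simp only [Fin.rev_rev]
    rw [this, ← Finset.sum_add_distrib]
    refine hnn.trans (le_of_eq (Finset.sum_congr rfl fun l _ => ?_))
    ring
  calc c₁ * c₂ ≤ c₁ * c₂ * (Real.exp (∑ l, ν₁ l * x l) * Real.exp (∑ l, ν₂ l * -x l.rev)) :=
        le_mul_of_one_le_right (mul_pos hc₁ hc₂).le hexp
    _ = c₁ * Real.exp (∑ l, ν₁ l * x l) * (c₂ * Real.exp (∑ l, ν₂ l * -x l.rev)) := by ring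
    _ ≤ _ := mul_le_mul h₁x h₂x (by positivity) (le_trans (by positivity) h₁x)

theorem isCompact_unitary : IsCompact {U : Matrix (Fin n) (Fin n) ℂ | U * Uᴴ = 1} := by
  have hK : IsCompact (Set.univ.pi fun _ : Fin n => Set.univ.pi fun _ : Fin n =>
      Metric.closedBall (0 : ℂ) 1) :=
    isCompact_univ_pi fun _ => isCompact_univ_pi fun _ => isCompact_closedBall _ _
  refine IsCompact.of_isClosed_subset hK (isClosed_eq (by fun_prop) continuous_const) ?_
  intro U hU i _ j _
  rw [mem_closedBall_zero_iff]
  exact entry_norm_bound_of_unitary (mem_unitaryGroup_iff.2 hU) i j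

/-- The local constants depend on the unitary but not on `x`, so finitely many neighbourhoods
suffice. -/
theorem exists_uniform_lower_bound (hp : IsSpectrum p) (hq : IsSpectrum q)
    (hsum : ∑ j, p j = ∑ i, q i) (h : RankNondecreasing A p q) :
    ∃ c > 0, ∀ V : Matrix (Fin n) (Fin n) ℂ, V * Vᴴ = 1 → ∀ x : Fin n → ℝ, Antitone x →
      c ≤ relDet q (krausMap A (V * (diagonal fun i => (Real.exp (x i) : ℂ)) * Vᴴ)) *
        relDet p (V * (diagonal fun i => (Real.exp (-x i) : ℂ)) * Vᴴ) := by
  refine (isCompact_unitary (n := n)).induction_on (p := fun s => ∃ c > 0, ∀ V ∈ s,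
    ∀ x : Fin n → ℝ, Antitone x →
      c ≤ relDet q (krausMap A (V * (diagonal fun i => (Real.exp (x i) : ℂ)) * Vᴴ)) *
        relDet p (V * (diagonal fun i => (Real.exp (-x i) : ℂ)) * Vᴴ)) ?_ ?_ ?_ ?_
  · exact ⟨1, one_pos, fun V hV => absurd hV (Set.notMem_empty V)⟩
  · rintro s t hst ⟨c, hc, hb⟩
    exact ⟨c, hc, fun V hV => hb V (hst hV)⟩
  · rintro s t ⟨c, hc, hb⟩ ⟨d, hd, hb'⟩
    refine ⟨min c d, lt_min hc hd, fun V hV x hx => ?_⟩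
    rcases hV with hV | hV
    · exact (min_le_left _ _).trans (hb V hV x hx)
    · exact (min_le_right _ _).trans (hb' V hV x hx)
  · intro U hU
    obtain ⟨c, hc, hb⟩ := exists_local_lower_bound hp hq hsum h hU
    exact ⟨_, mem_nhdsWithin_of_mem_nhds hb, c, hc, fun V hV => hV⟩

theorem exists_sorted_spectral {X : Matrix (Fin n) (Fin n) ℂ} (hX : X.PosDef) :
    ∃ V : Matrix (Fin n) (Fin n) ℂ, V * Vᴴ = 1 ∧ ∃ x : Fin n → ℝ, Antitone x ∧
      X = V * (diagonal fun i => (Real.exp (x i) : ℂ)) * Vᴴ := by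
  have hs := hX.1.spectral_theorem
  rw [Unitary.conjStarAlgAut_apply] at hs
  set U : Matrix (Fin n) (Fin n) ℂ := (hX.1.eigenvectorUnitary : Matrix (Fin n) (Fin n) ℂ)
  have hU : U * Uᴴ = 1 := Unitary.coe_mul_star_self hX.1.eigenvectorUnitary
  set μ := hX.1.eigenvalues
  let σ := Tuple.sort fun i => -μ i
  have hσ : Antitone fun i => μ (σ i) := fun i j hij => by
    have := Tuple.monotone_sort (fun i => -μ i) hij
    simpa using this
  refine ⟨U.submatrix id σ, ?_, fun i => Real.log (μ (σ i)), ?_, ?_⟩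
  · rw [conjTranspose_submatrix, submatrix_mul_equiv, hU, submatrix_id_id]
  · intro i j hij
    exact Real.log_le_log (hX.eigenvalues_pos _) (hσ hij)
  · have : (diagonal fun i => (Real.exp (Real.log (μ (σ i))) : ℂ)) =
        (diagonal fun i => (μ i : ℂ)).submatrix σ σ := by
      rw [submatrix_diagonal_equiv]
      congr 1
      funext i
      simp only [Function.comp]
      rw [Real.exp_log (hX.eigenvalues_pos _)]
    rw [this, conjTranspose_submatrix, submatrix_mul_equiv, submatrix_mul_equiv, submatrix_id_id]
    exact hs

theorem exists_posDef_lower_bound (hp : IsSpectrum p) (hq : IsSpectrum q)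
    (hsum : ∑ j, p j = ∑ i, q i) (h : RankNondecreasing A p q) :
    ∃ c > 0, ∀ X Y : Matrix (Fin n) (Fin n) ℂ, X.PosDef → X * Y = 1 →
      c ≤ relDet q (krausMap A X) * relDet p Y := by
  obtain ⟨c, hc, hb⟩ := exists_uniform_lower_bound hp hq hsum h
  refine ⟨c, hc, fun X Y hX hXY => ?_⟩
  obtain ⟨V, hV, x, hx, rfl⟩ := exists_sorted_spectral hX
  have hV' : Vᴴ * V = 1 := mul_eq_one_comm.1 hV
  have hY : Y = V * (diagonal fun i => (Real.exp (-x i) : ℂ)) * Vᴴ := by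
    refine (left_inv_eq_right_inv ?_ hXY).symm
    calc _ = V * ((diagonal fun i => (Real.exp (-x i) : ℂ)) * (Vᴴ * V) *
          (diagonal fun i => (Real.exp (x i) : ℂ))) * Vᴴ := by simp only [Matrix.mul_assoc]
      _ = 1 := by
        rw [hV', Matrix.mul_one, diagonal_mul_diagonal]
        have : ∀ i, (Real.exp (-x i) : ℂ) * (Real.exp (x i) : ℂ) = 1 := fun i => by
          rw [← Complex.ofReal_mul, ← Real.exp_add, neg_add_cancel, Real.exp_zero,
            Complex.ofReal_one]
        simp only [this, diagonal_one, Matrix.mul_one, hV]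
  rw [hY]
  exact hb V hV x hx

/-- Zeros of `p` are harmless: `Δ p j > 0` forces `p j > 0`, hence all earlier entries are positive.
-/
theorem relDet_diagC_pos (hp : IsSpectrum p) : 0 < relDet p (diagC p) := by
  refine Finset.prod_pos fun j _ => ?_
  rcases (hp.delta_nonneg j).eq_or_lt' with h0 | h0
  · rw [h0, Real.rpow_zero]
    exact one_pos
  · refine Real.rpow_pos_of_pos ?_ _
    have hpj : 0 < p j := by
      refine h0.trans_le ?_
      unfold delta
      split_ifs with hj
      · exact sub_le_self _ (hp.2 _)
      · rw [sub_zero]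
    have : leadingBlock (diagC p) j = diagonal fun i => (p (Fin.castLE j.isLt i) : ℂ) :=
      submatrix_diagonal _ _ (Fin.castLE_injective _)
    rw [this, det_diagonal]
    have hpos : 0 < ∏ i, p (Fin.castLE j.isLt i) :=
      Finset.prod_pos fun i _ => hpj.trans_le (hp.1 (Nat.le_of_lt_succ i.isLt))
    have e : ∏ i, (p (Fin.castLE j.isLt i) : ℂ) = ((∏ i, p (Fin.castLE j.isLt i) : ℝ) : ℂ) := by
      push_cast
      rfl
    rw [e, Complex.ofReal_re]
    exact hpos

theorem relDet_diagC_mul_inv {d : Fin n → ℝ} (hd : ∀ i, 0 < d i) :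
    relDet p (diagC d) * relDet p (diagC fun i => (d i)⁻¹) = 1 := by
  have hsq : diagC d = (diagC fun i => Real.sqrt (d i))ᴴ * diagC fun i => Real.sqrt (d i) := by
    rw [diagC_conjTranspose, diagC_mul]
    simp only [Real.mul_self_sqrt (hd _).le]
  rw [hsq, ← relDet_upper_conj p (diagC_posSemidef fun i => (inv_pos.2 (hd i)).le)
    (g := diagC _) (blockTriangular_diagonal _), diagC_conjTranspose, diagC_mul, diagC_mul]
  have : ∀ i, Real.sqrt (d i) * (d i)⁻¹ * Real.sqrt (d i) = 1 := fun i => by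
    rw [mul_right_comm, Real.mul_self_sqrt (hd i).le, mul_inv_cancel₀ (hd i).ne']
  simp only [this]
  have h1 : (diagC fun _ : Fin n => (1 : ℝ)) = 1 := by simp [diagC]
  rw [h1, relDet_one]

/-- Apply the uniform bound to `X = k D k†` with `D = diag(p + δ)`. Multiplicativity turns `relDet p
X⁻¹` into the reciprocal of `relDet p D * relDet p (k† k)`, and letting `δ` tend to zero bounds
every quotient below by `c * relDet p (diagC p)`. -/
theorem capacity_pos_of_rankNondecreasing (hp : IsSpectrum p) (hq : IsSpectrum q)
    (hsum : ∑ j, p j = ∑ i, q i) (h : RankNondecreasing A p q) : 0 < capacity A p q := by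
  obtain ⟨c, hc, hb⟩ := exists_posDef_lower_bound hp hq hsum h
  refine (mul_pos hc (relDet_diagC_pos hp)).trans_le ?_
  have : Nonempty (upperGL n) := ⟨⟨1, one_mem_upperGL n⟩⟩
  refine le_ciInf ?_
  rintro ⟨k, hk⟩
  rw [le_div_iff₀ (relDet_upper_pos p hk)]
  have hc1 : Continuous fun δ : ℝ => c * relDet p (diagC fun i => p i + δ) *
      relDet p (k.valᴴ * k.val) := by
    refine (continuous_const.mul ((continuous_relDet hp).comp ?_)).mul continuous_const
    unfold diagC
    fun_prop
  have hc2 : Continuous fun δ : ℝ =>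
      relDet q (krausMap A (k.val * (diagC fun i => p i + δ) * k.valᴴ)) := by
    refine (continuous_relDet hq).comp ((continuous_krausMap A).comp ?_)
    unfold diagC
    fun_prop
  have key : ∀ δ : ℝ, 0 < δ → c * relDet p (diagC fun i => p i + δ) *
      relDet p (k.valᴴ * k.val) ≤
        relDet q (krausMap A (k.val * (diagC fun i => p i + δ) * k.valᴴ)) := by
    intro δ hδ
    have hd : ∀ i, 0 < p i + δ := fun i => add_pos_of_nonneg_of_pos (hp.2 i) hδ
    set D := diagC fun i => p i + δ with hD
    set D' := diagC fun i => (p i + δ)⁻¹ with hD'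
    have hDD : D * D' = 1 := by
      rw [hD, hD', diagC_mul]
      simp [diagC, fun i => mul_inv_cancel₀ (hd i).ne']
    have hDp : D.PosDef := PosDef.diagonal fun i => by
      have := hd i
      exact_mod_cast this
    have hX : (k.val * D * k.valᴴ).PosDef := by
      have := (Matrix.IsUnit.posDef_star_right_conjugate_iff (x := D) k.isUnit).2 hDp
      simpa [star_eq_conjTranspose] using this
    have hkk : k.val * (k⁻¹).val = 1 := by rw [← Units.val_mul, mul_inv_cancel, Units.val_one]
    have hkk' : k.valᴴ * ((k⁻¹).val)ᴴ = 1 := by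
      rw [← conjTranspose_mul, mul_eq_one_comm.1 hkk, conjTranspose_one]
    have h1 := hb _ (((k⁻¹).val)ᴴ * D' * (k⁻¹).val) hX (by
      calc _ = k.val * (D * (k.valᴴ * ((k⁻¹).val)ᴴ) * D') * (k⁻¹).val := by
            simp only [Matrix.mul_assoc]
        _ = 1 := by rw [hkk', Matrix.mul_one, hDD, Matrix.mul_one, hkk])
    have hki := inv_mem_upperGL hk
    rw [relDet_upper_conj p (diagC_posSemidef fun i => (inv_pos.2 (hd i)).le) hki] at h1
    have h2 := relDet_diagC_mul_inv (p := p) hd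
    have h3 := relDet_upper_mul p (g := k⁻¹) hk
    rw [inv_mul_cancel, Units.val_one, conjTranspose_one, Matrix.one_mul, relDet_one] at h3
    rw [← hD, ← hD'] at h2
    have h4 : 0 ≤ relDet p D * relDet p (k.valᴴ * k.val) :=
      mul_nonneg (relDet_nonneg _ hDp.posSemidef) (relDet_upper_pos p hk).le
    calc _ = c * (relDet p D * relDet p (k.valᴴ * k.val)) := by ring
      _ ≤ _ := mul_le_mul_of_nonneg_right h1 h4
      _ = relDet q (krausMap A (k.val * D * k.valᴴ)) * (relDet p D * relDet p D') *
          (relDet p ((k⁻¹).valᴴ * (k⁻¹).val) * relDet p (k.valᴴ * k.val)) := by ring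
      _ = _ := by rw [h2, ← h3, mul_one, mul_one]
  have := le_of_tendsto_of_tendsto (hc1.continuousWithinAt (s := Set.Ioi (0 : ℝ)) (x := 0))
    (hc2.continuousWithinAt (s := Set.Ioi (0 : ℝ)) (x := 0))
    (Filter.eventually_of_mem self_mem_nhdsWithin key)
  simpa using this

end

/-! ### Polyhedra and their extreme points. -/

section

variable {E : Type*} [NormedAddCommGroup E] [NormedSpace ℝ E]

/-- The intersection of the half-spaces `f x ≤ b` for `(f, b)` in `F`. -/
def polyhedron (F : Set ((E →ₗ[ℝ] ℝ) × ℝ)) : Set E :=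
  {x | ∀ f ∈ F, f.1 x ≤ f.2}

/-- An extreme point of a polyhedron is determined by the inequalities that it satisfies with
equality. -/
theorem eq_of_mem_extremePoints_polyhedron {F : Set ((E →ₗ[ℝ] ℝ) × ℝ)} (hF : F.Finite) {x z : E}
    (hx : x ∈ (polyhedron F).extremePoints ℝ) (hz : ∀ f ∈ F, f.1 x = f.2 → f.1 z = f.2) :
    z = x := by
  -- Inequalities that are strict at `x` survive a small move along `±(z - x)`, and active ones are
  -- unaffected, so `x` is the midpoint of two points of the polyhedron.
  have hev : ∀ f ∈ F, ∀ᶠ ε in nhdsWithin (0 : ℝ) (Set.Ioi 0),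
      f.1 (x + ε • (z - x)) ≤ f.2 ∧ f.1 (x - ε • (z - x)) ≤ f.2 := by
    intro f hf
    have hxf := hx.1 f hf
    rcases hxf.lt_or_eq with h | h
    · have h1 : Continuous fun ε : ℝ => f.1 x + ε * (f.1 z - f.1 x) := by fun_prop
      have h2 : Continuous fun ε : ℝ => f.1 x - ε * (f.1 z - f.1 x) := by fun_prop
      have e1 := h1.continuousAt.eventually_lt (x₀ := 0) (continuousAt_const (y := f.2)) (by simpa)
      have e2 := h2.continuousAt.eventually_lt (x₀ := 0) (continuousAt_const (y := f.2)) (by simpa)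
      refine Filter.Eventually.filter_mono nhdsWithin_le_nhds ?_
      filter_upwards [e1, e2] with ε h1 h2
      simp only [map_add, map_sub, map_smul, smul_eq_mul]
      exact ⟨h1.le, h2.le⟩
    · refine Filter.Eventually.of_forall fun ε => ?_
      simp [hz f hf h, h]
  obtain ⟨ε, hε, hε0⟩ := (((Filter.eventually_all_finite hF).2 hev).and
    self_mem_nhdsWithin).exists
  have hε0' : (0 : ℝ) < ε := hε0
  have h1 := hx.2 (x₁ := x + ε • (z - x)) (fun f hf => (hε f hf).1)
    (x₂ := x - ε • (z - x)) (fun f hf => (hε f hf).2)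
    ⟨1 / 2, 1 / 2, by norm_num, by norm_num, by norm_num, by module⟩
  have h2 : ε • (z - x) = 0 := by simpa using h1
  exact sub_eq_zero.1 ((smul_eq_zero.1 h2).resolve_left hε0'.ne')

theorem convex_polyhedron (F : Set ((E →ₗ[ℝ] ℝ) × ℝ)) : Convex ℝ (polyhedron F) := by
  intro x hx y hy a b ha hb hab f hf
  have h1 := mul_le_mul_of_nonneg_left (hx f hf) ha
  have h2 := mul_le_mul_of_nonneg_left (hy f hf) hb
  rw [map_add, map_smul, map_smul, smul_eq_mul, smul_eq_mul]
  calc _ ≤ a * f.2 + b * f.2 := add_le_add h1 h2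
    _ = f.2 := by rw [← add_mul, hab, one_mul]

theorem isClosed_polyhedron [FiniteDimensional ℝ E] (F : Set ((E →ₗ[ℝ] ℝ) × ℝ)) :
    IsClosed (polyhedron F) := by
  have : polyhedron F = ⋂ f ∈ F, {x | f.1 x ≤ f.2} := by
    ext
    simp [polyhedron]
  rw [this]
  exact isClosed_biInter fun f _ =>
    isClosed_le f.1.continuous_of_finiteDimensional continuous_const

/-- Sending an extreme point to its set of active inequalities is injective. -/
theorem finite_extremePoints_polyhedron {F : Set ((E →ₗ[ℝ] ℝ) × ℝ)} (hF : F.Finite) :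
    ((polyhedron F).extremePoints ℝ).Finite := by
  have hfin : {G | G ⊆ F}.Finite := hF.finite_subsets
  refine Set.Finite.of_injOn (f := fun x => {f ∈ F | f.1 x = f.2}) (t := {G | G ⊆ F})
    (fun x _ f hf => hf.1) ?_ hfin
  intro x hx y hy hxy
  refine (eq_of_mem_extremePoints_polyhedron hF hx fun f hf h => ?_).symm
  have : f ∈ {f ∈ F | f.1 x = f.2} := ⟨hf, h⟩
  rw [show {f ∈ F | f.1 x = f.2} = {f ∈ F | f.1 y = f.2} from hxy] at this
  exact this.2

/-- Krein–Milman; the closure is superfluous because the hull of finitely many points is closed. -/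
theorem polyhedron_eq_convexHull [FiniteDimensional ℝ E] {F : Set ((E →ₗ[ℝ] ℝ) × ℝ)}
    (hF : F.Finite) (hc : IsCompact (polyhedron F)) :
    polyhedron F = convexHull ℝ ((polyhedron F).extremePoints ℝ) := by
  have h := closure_convexHull_extremePoints hc (convex_polyhedron F)
  rwa [((finite_extremePoints_polyhedron hF).isClosed_convexHull ℝ).closure_eq, eq_comm] at h

end

/-! ### Rationality of the vertices. -/

/-- A `ℚ`-linear retraction of the reals onto the rationals. -/
theorem exists_retraction_rat : ∃ φ : ℝ →ₗ[ℚ] ℚ, ∀ c : ℚ, φ c = c := by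
  obtain ⟨φ, hφ⟩ := LinearMap.exists_leftInverse_of_injective (Algebra.linearMap ℚ ℝ)
    (LinearMap.ker_eq_bot.2 (algebraMap ℚ ℝ).injective)
  exact ⟨φ, fun c => LinearMap.congr_fun hφ c⟩

section

variable {m n : ℕ}

/-- Coordinatewise application of `φ`. -/
noncomputable def ratPoint (φ : ℝ →ₗ[ℚ] ℚ) (x : (Fin n → ℝ) × (Fin m → ℝ)) : (Fin n → ℝ) × (Fin m → ℝ) :=
  (fun j => φ (x.1 j), fun i => φ (x.2 i))

/-- The functional `f` commutes with `φ`, as those with rational coefficients do. -/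
def IsRatFunctional (φ : ℝ →ₗ[ℚ] ℚ) (f : ((Fin n → ℝ) × (Fin m → ℝ)) →ₗ[ℝ] ℝ) : Prop :=
  ∀ x, f (ratPoint φ x) = φ (f x)

/-- Applying `φ` to the coordinates of `x` preserves its active equations, and these determine `x`,
so `φ` fixes every coordinate. -/
theorem isRationalPoint_of_mem_extremePoints {φ : ℝ →ₗ[ℚ] ℚ} (hφ : ∀ c : ℚ, φ c = c)
    {F : Set ((((Fin n → ℝ) × (Fin m → ℝ)) →ₗ[ℝ] ℝ) × ℝ)} (hF : F.Finite)
    (hrat : ∀ f ∈ F, IsRatFunctional φ f.1 ∧ ∃ c : ℚ, f.2 = c)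
    {x : (Fin n → ℝ) × (Fin m → ℝ)} (hx : x ∈ (polyhedron F).extremePoints ℝ) :
    IsRationalPoint x := by
  have h : ratPoint φ x = x := by
    refine eq_of_mem_extremePoints_polyhedron hF hx fun f hf h => ?_
    obtain ⟨hf1, c, hc⟩ := hrat f hf
    rw [hf1, h, hc, hφ]
  exact ⟨fun j => ⟨φ (x.1 j), (congrFun (congrArg Prod.fst h) j).symm⟩,
    fun i => ⟨φ (x.2 i), (congrFun (congrArg Prod.snd h) i).symm⟩⟩

/-- The coordinate functionals of the first factor. -/
noncomputable def coordFst (j : Fin n) : ((Fin n → ℝ) × (Fin m → ℝ)) →ₗ[ℝ] ℝ :=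
  LinearMap.proj j ∘ₗ LinearMap.fst ℝ _ _

/-- The coordinate functionals of the second factor. -/
noncomputable def coordSnd (i : Fin m) : ((Fin n → ℝ) × (Fin m → ℝ)) →ₗ[ℝ] ℝ :=
  LinearMap.proj i ∘ₗ LinearMap.snd ℝ _ _

namespace IsRatFunctional

variable {φ : ℝ →ₗ[ℚ] ℚ} {f g : ((Fin n → ℝ) × (Fin m → ℝ)) →ₗ[ℝ] ℝ}

theorem coordFst (j : Fin n) : IsRatFunctional (m := m) φ (coordFst j) := fun _ => rfl

theorem coordSnd (i : Fin m) : IsRatFunctional (n := n) φ (coordSnd i) := fun _ => rfl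

theorem zero : IsRatFunctional (n := n) (m := m) φ 0 := fun x => by simp

theorem neg (hf : IsRatFunctional φ f) : IsRatFunctional φ (-f) := fun x => by
  rw [LinearMap.neg_apply, LinearMap.neg_apply, hf x, map_neg, Rat.cast_neg]

theorem add (hf : IsRatFunctional φ f) (hg : IsRatFunctional φ g) :
    IsRatFunctional φ (f + g) := fun x => by
  rw [LinearMap.add_apply, LinearMap.add_apply, hf x, hg x, map_add, Rat.cast_add]

theorem sub (hf : IsRatFunctional φ f) (hg : IsRatFunctional φ g) :
    IsRatFunctional φ (f - g) := fun x => by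
  rw [LinearMap.sub_apply, LinearMap.sub_apply, hf x, hg x, map_sub, Rat.cast_sub]

theorem nsmul (hf : IsRatFunctional φ f) (k : ℕ) : IsRatFunctional φ (k • f) := fun x => by
  rw [LinearMap.smul_apply, LinearMap.smul_apply, hf x, map_nsmul, nsmul_eq_mul, nsmul_eq_mul,
    Rat.cast_mul, Rat.cast_natCast]

theorem sum {ι : Type*} {s : Finset ι} {f : ι → ((Fin n → ℝ) × (Fin m → ℝ)) →ₗ[ℝ] ℝ}
    (h : ∀ i ∈ s, IsRatFunctional φ (f i)) : IsRatFunctional φ (∑ i ∈ s, f i) := fun x => by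
  rw [LinearMap.sum_apply, LinearMap.sum_apply, map_sum, Rat.cast_sum]
  exact Finset.sum_congr rfl fun i hi => h i hi x

end IsRatFunctional

/-- The functional `∑ d_i Δ f_i` for a family `f` of functionals. -/
noncomputable def deltaFunctional {k : ℕ} (f : Fin k → ((Fin n → ℝ) × (Fin m → ℝ)) →ₗ[ℝ] ℝ) (d : Fin k → ℕ) :
    ((Fin n → ℝ) × (Fin m → ℝ)) →ₗ[ℝ] ℝ :=
  ∑ i, d i • (f i - if h : (i : ℕ) + 1 < k then f ⟨(i : ℕ) + 1, h⟩ else 0)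

theorem deltaFunctional_apply {k : ℕ} (f : Fin k → ((Fin n → ℝ) × (Fin m → ℝ)) →ₗ[ℝ] ℝ)
    (d : Fin k → ℕ) (x : (Fin n → ℝ) × (Fin m → ℝ)) :
    deltaFunctional f d x = ∑ i, delta (fun i => f i x) i * (d i : ℝ) := by
  rw [deltaFunctional, LinearMap.sum_apply]
  refine Finset.sum_congr rfl fun i _ => ?_
  rw [LinearMap.smul_apply, LinearMap.sub_apply, nsmul_eq_mul, mul_comm, delta]
  split_ifs <;> rfl

theorem IsRatFunctional.deltaFunctional {φ : ℝ →ₗ[ℚ] ℚ} {k : ℕ}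
    {f : Fin k → ((Fin n → ℝ) × (Fin m → ℝ)) →ₗ[ℝ] ℝ} (hf : ∀ i, IsRatFunctional φ (f i))
    (d : Fin k → ℕ) : IsRatFunctional φ (deltaFunctional f d) := by
  refine IsRatFunctional.sum fun i _ => ((hf i).sub ?_).nsmul _
  split_ifs
  · exact hf _
  · exact IsRatFunctional.zero

/-! ### The defining inequalities and the final assembly. -/

/-- Inequalities that cut out the pairs of nonincreasing nonnegative sequences with sum one. -/
noncomputable def unitSpectraIneqs (n m : ℕ) : Set ((((Fin n → ℝ) × (Fin m → ℝ)) →ₗ[ℝ] ℝ) × ℝ) :=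
  Set.range (fun t : {t : Fin n × Fin n // t.1 ≤ t.2} => (coordFst t.1.2 - coordFst t.1.1, 0)) ∪
  Set.range (fun t : {t : Fin m × Fin m // t.1 ≤ t.2} => (coordSnd t.1.2 - coordSnd t.1.1, 0)) ∪
  Set.range (fun j => (-coordFst j, 0)) ∪ Set.range (fun i => (-coordSnd i, 0)) ∪
  {(∑ j, coordFst j, 1), (-∑ j, coordFst j, -1), (∑ i, coordSnd i, 1), (-∑ i, coordSnd i, -1)}

theorem mem_unitSpectra_iff {x : (Fin n → ℝ) × (Fin m → ℝ)} :
    x ∈ unitSpectra n m ↔ x ∈ polyhedron (unitSpectraIneqs n m) := by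
  have hsum1 : (∑ j, coordFst (m := m) j) x = ∑ j, x.1 j := by
    rw [LinearMap.sum_apply]
    rfl
  have hsum2 : (∑ i, coordSnd (n := n) i) x = ∑ i, x.2 i := by
    rw [LinearMap.sum_apply]
    rfl
  constructor
  · rintro ⟨⟨h1, h2⟩, ⟨h3, h4⟩, h5, h6⟩ f
      ((((⟨t, rfl⟩ | ⟨t, rfl⟩) | ⟨t, rfl⟩) | ⟨t, rfl⟩) | (rfl | rfl | rfl | rfl))
    · exact sub_nonpos.2 (h1 t.2)
    · exact sub_nonpos.2 (h3 t.2)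
    · exact neg_nonpos.2 (h2 t)
    · exact neg_nonpos.2 (h4 t)
    · exact (hsum1.trans h5).le
    · exact neg_le_neg (hsum1.trans h5).ge
    · exact (hsum2.trans h6).le
    · exact neg_le_neg (hsum2.trans h6).ge
  · intro h
    refine ⟨⟨fun i j hij => ?_, fun i => ?_⟩, ⟨fun i j hij => ?_, fun i => ?_⟩, ?_, ?_⟩
    · exact sub_nonpos.1 (h _ (.inl (.inl (.inl (.inl ⟨⟨(i, j), hij⟩, rfl⟩)))))
    · exact neg_nonpos.1 (h _ (.inl (.inl (.inr ⟨i, rfl⟩))))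
    · exact sub_nonpos.1 (h _ (.inl (.inl (.inl (.inr ⟨⟨(i, j), hij⟩, rfl⟩)))))
    · exact neg_nonpos.1 (h _ (.inl (.inr ⟨i, rfl⟩)))
    · exact le_antisymm (hsum1.ge.trans (h _ (.inr (.inl rfl))))
        ((neg_le_neg_iff.1 (h _ (.inr (.inr (.inl rfl))))).trans hsum1.le)
    · exact le_antisymm (hsum2.ge.trans (h _ (.inr (.inr (.inr (.inl rfl))))))
        ((neg_le_neg_iff.1 (h _ (.inr (.inr (.inr (.inr rfl)))))).trans hsum2.le)

theorem isRatFunctional_unitSpectraIneqs {φ : ℝ →ₗ[ℚ] ℚ} :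
    ∀ f ∈ unitSpectraIneqs n m, IsRatFunctional φ f.1 ∧ ∃ c : ℚ, f.2 = c := by
  have h1 : IsRatFunctional (n := n) (m := m) φ (∑ j, coordFst j) :=
    .sum fun j _ => .coordFst j
  have h2 : IsRatFunctional (n := n) (m := m) φ (∑ i, coordSnd i) :=
    .sum fun i _ => .coordSnd i
  rintro f ((((⟨t, rfl⟩ | ⟨t, rfl⟩) | ⟨t, rfl⟩) | ⟨t, rfl⟩) | (rfl | rfl | rfl | rfl))
  · exact ⟨(IsRatFunctional.coordFst _).sub (.coordFst _), 0, by simp⟩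
  · exact ⟨(IsRatFunctional.coordSnd _).sub (.coordSnd _), 0, by simp⟩
  · exact ⟨(IsRatFunctional.coordFst _).neg, 0, by simp⟩
  · exact ⟨(IsRatFunctional.coordSnd _).neg, 0, by simp⟩
  · exact ⟨h1, 1, by simp⟩
  · exact ⟨h1.neg, -1, by simp⟩
  · exact ⟨h2, 1, by simp⟩
  · exact ⟨h2.neg, -1, by simp⟩

theorem finite_unitSpectraIneqs : (unitSpectraIneqs n m).Finite :=
  ((((Set.finite_range _).union (Set.finite_range _)).union (Set.finite_range _)).union
    (Set.finite_range _)).union (Set.toFinite _)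

theorem unitSpectra_subset_Icc : unitSpectra n m ⊆ Set.Icc 0 1 := by
  rintro x ⟨hp, hq, h1, h2⟩
  refine ⟨⟨fun j => hp.2 j, fun i => hq.2 i⟩, ⟨fun j => ?_, fun i => ?_⟩⟩
  · have := Finset.single_le_sum (fun j _ => hp.2 j) (Finset.mem_univ j)
    rwa [h1] at this
  · have := Finset.single_le_sum (fun i _ => hq.2 i) (Finset.mem_univ i)
    rwa [h2] at this

variable {r : ℕ}

/-- The functional `(p, q) ↦ ∑ d_i Δ q_i + ∑ e_j Δ p_j - ∑ p_j`. -/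
noncomputable def rankFunctional (t : (Fin m → ℕ) × (Fin n → ℕ)) :
    ((Fin n → ℝ) × (Fin m → ℝ)) →ₗ[ℝ] ℝ :=
  deltaFunctional coordSnd t.1 + deltaFunctional coordFst t.2 - ∑ j, coordFst j

/-- Inequalities that express `RankNondecreasing`. -/
noncomputable def rankIneqs (A : Fin r → Matrix (Fin m) (Fin n) ℂ) :
    Set ((((Fin n → ℝ) × (Fin m → ℝ)) →ₗ[ℝ] ℝ) × ℝ) :=
  (fun t : (Fin m → ℕ) × (Fin n → ℕ) => (rankFunctional t, 0)) ''
    {t | ∃ L R, Independent A L R ∧ t = (fun i => Module.finrank ℂ ↥(stdFlag i ⊓ L),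
      fun j => Module.finrank ℂ ↥(stdFlag j ⊓ R))}

theorem rankNondecreasing_iff_mem_polyhedron (A : Fin r → Matrix (Fin m) (Fin n) ℂ)
    {x : (Fin n → ℝ) × (Fin m → ℝ)} :
    RankNondecreasing A x.1 x.2 ↔ x ∈ polyhedron (rankIneqs A) := by
  have h : ∀ t : (Fin m → ℕ) × (Fin n → ℕ), rankFunctional t x ≤ 0 ↔
      ∑ i, delta x.2 i * (t.1 i : ℝ) + ∑ j, delta x.1 j * (t.2 j : ℝ) ≤ ∑ j, x.1 j := by
    intro t
    rw [rankFunctional, LinearMap.sub_apply, LinearMap.add_apply, deltaFunctional_apply, deltaFunctional_apply,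
      LinearMap.sum_apply, sub_nonpos]
    rfl
  constructor
  · rintro hA _ ⟨_, ⟨L, R, hLR, rfl⟩, rfl⟩
    exact (h (fun i => Module.finrank ℂ ↥(stdFlag i ⊓ L),
      fun j => Module.finrank ℂ ↥(stdFlag j ⊓ R))).2 (hA L R hLR)
  · intro hx L R hLR
    exact (h (fun i => Module.finrank ℂ ↥(stdFlag i ⊓ L),
      fun j => Module.finrank ℂ ↥(stdFlag j ⊓ R))).1 (hx _ ⟨_, ⟨L, R, hLR, rfl⟩, rfl⟩)

/-- There may be infinitely many pairs `(L, R)`, but the inequality depends only on intersection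
dimensions, which are bounded by `m` and `n`. -/
theorem finite_rankIneqs (A : Fin r → Matrix (Fin m) (Fin n) ℂ) : (rankIneqs A).Finite := by
  classical
  refine Set.Finite.image _ (Set.Finite.subset (Set.finite_Icc 0 ((fun _ => m), (fun _ => n))) ?_)
  rintro _ ⟨L, R, -, rfl⟩
  refine ⟨⟨fun i => Nat.zero_le _, fun j => Nat.zero_le _⟩, ⟨fun i => ?_, fun j => ?_⟩⟩
  · exact (Submodule.finrank_le _).trans (by simp)
  · exact (Submodule.finrank_le _).trans (by simp)

theorem exists_rational_polytope (A : Fin r → Matrix (Fin m) (Fin n) ℂ) :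
    ∃ S : Set ((Fin n → ℝ) × (Fin m → ℝ)), S.Finite ∧ (∀ x ∈ S, IsRationalPoint x) ∧
      {x ∈ unitSpectra n m | RankNondecreasing A x.1 x.2} = convexHull ℝ S := by
  have hset : {x ∈ unitSpectra n m | RankNondecreasing A x.1 x.2} =
      polyhedron (unitSpectraIneqs n m ∪ rankIneqs A) := by
    ext x
    rw [Set.mem_ofPred_eq, mem_unitSpectra_iff, rankNondecreasing_iff_mem_polyhedron]
    simp only [polyhedron, Set.mem_union, or_imp, forall_and, Set.mem_ofPred_eq]
  have hfin := (finite_unitSpectraIneqs (n := n) (m := m)).union (finite_rankIneqs A)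
  obtain ⟨φ, hφ⟩ := exists_retraction_rat
  refine ⟨_, finite_extremePoints_polyhedron hfin, fun x hx =>
    isRationalPoint_of_mem_extremePoints hφ hfin ?_ hx, ?_⟩
  · rintro f (hf | ⟨t, -, rfl⟩)
    · exact isRatFunctional_unitSpectraIneqs f hf
    · exact ⟨((IsRatFunctional.deltaFunctional .coordSnd _).add
        (.deltaFunctional .coordFst _)).sub (.sum fun j _ => .coordFst j), 0, by simp⟩
  · rw [hset]
    refine polyhedron_eq_convexHull hfin ?_
    refine IsCompact.of_isClosed_subset (isCompact_Icc (a := 0) (b := 1))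
      (isClosed_polyhedron _) ?_
    rw [← hset]
    exact Set.Subset.trans (fun x hx => hx.1) unitSpectra_subset_Icc

theorem tfae_scaling (A : Fin r → Matrix (Fin m) (Fin n) ℂ) {p : Fin n → ℝ} {q : Fin m → ℝ}
    (hp : IsSpectrum p) (hq : IsSpectrum q) :
    List.TFAE [∑ j, p j = ∑ i, q i ∧ RankNondecreasing A p q, 0 < capacity A p q,
      TriangularScalable A p q] := by
  tfae_have 1 → 2 := fun h => capacity_pos_of_rankNondecreasing hp hq h.1 h.2
  tfae_have 2 → 3 := triangularScalable_of_capacity_pos hp hq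
  tfae_have 3 → 1 := fun h =>
    ⟨sum_eq_of_triangularScalable h, rankNondecreasing_of_triangularScalable hp hq h⟩
  tfae_finish

end

end OpScaling

theorem mainTheorem1 (m n r : ℕ) (A : Fin r → Matrix (Fin m) (Fin n) ℂ) :
    (∀ (p : Fin n → ℝ) (q : Fin m → ℝ),
      OpScaling.IsSpectrum p → OpScaling.IsSpectrum q →
        List.TFAE [
          ∑ j, p j = ∑ i, q i ∧ OpScaling.RankNondecreasing A p q,
          0 < OpScaling.capacity A p q,
          OpScaling.TriangularScalable A p q]) ∧
    (∃ S : Set ((Fin n → ℝ) × (Fin m → ℝ)),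
      S.Finite ∧ (∀ x ∈ S, OpScaling.IsRationalPoint x) ∧
      {x ∈ OpScaling.unitSpectra n m | OpScaling.RankNondecreasing A x.1 x.2} =
        convexHull ℝ S ∧
      {x ∈ OpScaling.unitSpectra n m | 0 < OpScaling.capacity A x.1 x.2} =
        convexHull ℝ S ∧
      {x ∈ OpScaling.unitSpectra n m | OpScaling.TriangularScalable A x.1 x.2} =
        convexHull ℝ S) := by
  refine ⟨fun p q hp hq => OpScaling.tfae_scaling A hp hq, ?_⟩
  obtain ⟨S, hS, hrat, hSeq⟩ := OpScaling.exists_rational_polytope A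
  refine ⟨S, hS, hrat, hSeq, ?_, ?_⟩
  · rw [← hSeq]
    ext x
    refine and_congr_right fun hx => ?_
    rw [((OpScaling.tfae_scaling A hx.1 hx.2.1).out 1 0 :)]
    -- Both sums are one on `unitSpectra`, so the trace condition is automatic there.
    exact and_iff_right (hx.2.2.1.trans hx.2.2.2.symm)
  · rw [← hSeq]
    ext x
    refine and_congr_right fun hx => ?_
    rw [((OpScaling.tfae_scaling A hx.1 hx.2.1).out 2 0 :)]
    exact and_iff_right (hx.2.2.1.trans hx.2.2.2.symm)
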